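/- Let $n\ge 2$ qudits of local dimension $q\ge 2$ sit at the vertices of the complete graph $\mathrm{CG}$ on $n$ vertices. For a unitary $U$ write $U^{\otimes k,k}=U^{\otimes k}\otimes\overline{U}^{\otimes k}$, and let $$H(\mathrm{CG},n,k)=\sum_{i<j}\Big(\mathbb I-\int_{\mathcal U(q^2)}U_{(i,j)}^{\otimes k,k}\otimes\mathbb I_{[n]\setminus\{i,j\}}^{\otimes k,k}\,d\mu_{\rm Haar}(U)\Big),$$ where $U_{(i,j)}$ acts on the qudits $i,j$. Let $\Delta(\mathrm{CG},n,k)$ be its spectral gap, i.e. the difference between its two smallest distinct eigenvalues. A complete-graph random quantum circuit (RQC) of size $t$ is a product of $t$ independent gates, each a Haar-random element of $\mathcal U(q^2)$ applied to a uniformly random pair of qudits; let $\nu^{*t}$ be its distribution on $\mathcal U(q^n)$. A probability measure $\nu$ on $\mathcal U(q^n)$ is an $\varepsilon$-approximate unitary $2$-design * in the diamond-norm sense if the channels $\Phi_\nu(X)=\int U^{\otimes 2}XU^{\dagger\otimes 2}\,d\nu(U)$ satisfy $\|\Phi_\nu-\Phi_{\rm Haar}\|_\diamond\le\varepsilon/q^{2n}$;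 * in the operator-norm sense if the moment operators $M_\nu=\int U^{\otimes 2,2}\,d\nu(U)$ satisfy $\|M_\nu-M_{\rm Haar}\|_\infty\le\varepsilon/q^{4n}$. Then: 1. For every fixed $q\ge 2$, $\Delta(\mathrm{CG},n,2)=\Theta(n)$ as $n\to\infty$. More precisely, for all $q\ge2$ and $n\ge 2$, $$(n-2)\Big(1-\frac{2q}{q^2+1}\Big)\le\Delta(\mathrm{CG},n,2)\le n-1 .$$ 2. For all $q\ge 2$, $n\ge2$, $\varepsilon>0$ and every integer $t\ge0$ with $$t\ \ge\ \frac n2\Big(1-\frac{2q}{q^2+1}\Big)^{-1}\big(4n\log q+\log(1/\varepsilon)\big),$$ the measure $\nu^{*t}$ is an $\varepsilon$-approximate unitary $2$-design in both senses. In particular, there is an absolute constant $C>0$ such that for all $q\ge2$, $n\ge2$ and $0<\varepsilon\le1$ this holds for every $t\ge C\,n\,(n\log q+\log(1/\varepsilon))$; that is, complete-graph RQCs form $\varepsilon$-approximate unitary $2$-designs in size $O(n(n\log q+\log 1/\varepsilon))$. -/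

import Mathlib

open MeasureTheory
open scoped ENNReal Matrix

noncomputable section

namespace RQC

section UnitaryGroup

variable {ι : Type*} [Fintype ι] [DecidableEq ι]

instance instMeasurableSpaceUnitary : MeasurableSpace (Matrix.unitaryGroup ι ℂ) := borel _

instance instBorelSpaceUnitary : BorelSpace (Matrix.unitaryGroup ι ℂ) := ⟨rfl⟩

instance instCompactSpaceUnitary : CompactSpace (Matrix.unitaryGroup ι ℂ) := by
  refine (isCompact_iff_compactSpace (s := (Matrix.unitaryGroup ι ℂ : Set (Matrix ι ι ℂ)))).1 ?_
  have hK : IsCompact (Set.univ.pi fun _ : ι => Set.univ.pi fun _ : ι =>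
      Metric.closedBall (0 : ℂ) 1) :=
    isCompact_univ_pi fun _ => isCompact_univ_pi fun _ => isCompact_closedBall 0 1
  refine IsCompact.of_isClosed_subset (X := Matrix ι ι ℂ) hK isClosed_unitary ?_
  intro U hU i _ j _
  simpa using entry_norm_bound_of_unitary hU i j

/-- The Haar probability measure on the unitary group. -/
def haar (ι : Type*) [Fintype ι] [DecidableEq ι] : Measure (Matrix.unitaryGroup ι ℂ) :=
  Measure.haarMeasure ⊤

end UnitaryGroup

/-- Computational basis labels of `n` qudits of local dimension `q`; the `n`-qudit Hilbert space
is `ℂ ^ Config q n`. -/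
abbrev Config (q n : ℕ) : Type := Fin n → Fin q

/-- `U_{(i,j)} ⊗ 𝕀` on the sites other than `i, j`: the two-qudit matrix `A` acting on the ordered
pair of sites `(i, j)` of an `n`-qudit system, as a matrix. -/
def embedMatrix {q n : ℕ} (i j : Fin n) (A : Matrix (Fin q × Fin q) (Fin q × Fin q) ℂ) :
    Matrix (Config q n) (Config q n) ℂ :=
  Matrix.of fun x y =>
    if ∀ l, l ≠ i → l ≠ j → x l = y l then A (x i, x j) (y i, y j) else 0

theorem embedMatrix_one {q n : ℕ} (i j : Fin n) :
    embedMatrix i j (1 : Matrix (Fin q × Fin q) (Fin q × Fin q) ℂ) = 1 := by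
  ext x y
  simp only [embedMatrix, Matrix.of_apply, Matrix.one_apply, Prod.mk.injEq]
  by_cases h : x = y
  · simp [h]
  · rw [if_neg h]
    by_cases h1 : ∀ l, l ≠ i → l ≠ j → x l = y l
    · rw [if_pos h1, if_neg]
      rintro ⟨hi, hj⟩
      apply h
      funext l
      by_cases hli : l = i
      · rw [hli, hi]
      · by_cases hlj : l = j
        · rw [hlj, hj]
        · exact h1 l hli hlj
    · rw [if_neg h1]

theorem embedMatrix_star {q n : ℕ} (i j : Fin n)
    (A : Matrix (Fin q × Fin q) (Fin q × Fin q) ℂ) :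
    embedMatrix i j (star A) = star (embedMatrix i j A) := by
  ext x y
  simp only [embedMatrix, Matrix.of_apply, Matrix.star_apply]
  by_cases h : ∀ l, l ≠ i → l ≠ j → x l = y l
  · have h' : ∀ l, l ≠ i → l ≠ j → y l = x l := fun l a b => (h l a b).symm
    rw [if_pos h, if_pos h']
  · have h' : ¬ ∀ l, l ≠ i → l ≠ j → y l = x l :=
      fun h' => h fun l a b => (h' l a b).symm
    rw [if_neg h, if_neg h', star_zero]

theorem embedMatrix_mul {q n : ℕ} {i j : Fin n} (hij : i ≠ j)
    (A B : Matrix (Fin q × Fin q) (Fin q × Fin q) ℂ) :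
    embedMatrix i j (A * B) = embedMatrix i j A * embedMatrix i j B := by
  ext x z
  rw [Matrix.mul_apply]
  have key : ∑ p : Fin q × Fin q,
      (if ∀ l, l ≠ i → l ≠ j → x l = z l then A (x i, x j) p * B p (z i, z j) else 0) =
      ∑ y, embedMatrix i j A x y * embedMatrix i j B y z := by
    refine Finset.sum_of_injOn
      (fun p => Function.update (Function.update x i p.1) j p.2) ?_ ?_ ?_ ?_
    · rintro ⟨a, b⟩ - ⟨c, d⟩ - h
      have h1 := congrFun h i
      have h2 := congrFun h j
      simp [hij] at h1 h2
      simp [h1, h2]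
    · intro p _
      simp
    · intro y _ hy
      have : ¬ ∀ l, l ≠ i → l ≠ j → x l = y l := by
        intro h
        apply hy
        refine ⟨(y i, y j), by simp, ?_⟩
        funext l
        by_cases hlj : l = j
        · subst hlj; simp
        · by_cases hli : l = i
          · subst hli; simp [hlj]
          · simp [hlj, hli, h l hli hlj]
      simp only [embedMatrix, Matrix.of_apply]
      rw [if_neg this, zero_mul]
    · rintro ⟨a, b⟩ _
      have e1 : ∀ l, l ≠ i → l ≠ j →
          x l = Function.update (Function.update x i a) j b l := by
        intro l hi hj
        simp [hi, hj]
      have e2 : (∀ l, l ≠ i → l ≠ j →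
          Function.update (Function.update x i a) j b l = z l) ↔
          ∀ l, l ≠ i → l ≠ j → x l = z l := by
        refine forall_congr' fun l => forall_congr' fun hi => forall_congr' fun hj => ?_
        rw [e1 l hi hj]
      simp only [embedMatrix, Matrix.of_apply]
      rw [if_pos e1]
      simp only [e2]
      simp [hij]
  rw [← key]
  simp only [embedMatrix, Matrix.of_apply, Matrix.mul_apply]
  split_ifs <;> simp

/-- The gate `U` applied to the sites `i ≠ j`, as an `n`-qudit unitary. -/
def gate {q n : ℕ} {i j : Fin n} (hij : i ≠ j)
    (U : Matrix.unitaryGroup (Fin q × Fin q) ℂ) : Matrix.unitaryGroup (Config q n) ℂ :=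
  ⟨embedMatrix i j U.1, by
    rw [Matrix.mem_unitaryGroup_iff, ← embedMatrix_star, ← embedMatrix_mul hij,
      Matrix.mem_unitaryGroup_iff.1 U.2, embedMatrix_one]⟩

/-- The edges of a graph on `Fin n`, each listed once as an ordered pair `i < j`. -/
abbrev Edge {n : ℕ} (G : SimpleGraph (Fin n)) : Type :=
  {e : Fin n × Fin n // e.1 < e.2 ∧ G.Adj e.1 e.2}

instance instFintypeEdge {n : ℕ} (G : SimpleGraph (Fin n)) : Fintype (Edge G) :=
  Fintype.ofFinite _

/-- The distribution on `U(q^n)` of one step of the local random quantum circuit on `G`: a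
uniformly random edge and a Haar random two-qudit gate on it. -/
def stepMeasure (q : ℕ) {n : ℕ} (G : SimpleGraph (Fin n)) :
    Measure (Matrix.unitaryGroup (Config q n) ℂ) :=
  (Fintype.card (Edge G) : ℝ≥0∞)⁻¹ •
    ∑ e : Edge G, (haar (Fin q × Fin q)).map (gate e.2.1.ne)

/-- The distribution of a local random quantum circuit of size `t`: the `t`-fold convolution of
the one-step distribution. -/
def circuitMeasure (q : ℕ) {n : ℕ} (G : SimpleGraph (Fin n)) :
    ℕ → Measure (Matrix.unitaryGroup (Config q n) ℂ)
  | 0 => Measure.dirac 1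
  | t + 1 => (stepMeasure q G).mconv (circuitMeasure q G t)

section Moments

variable {ι : Type*} [Fintype ι] [DecidableEq ι]

/-- `A^{⊗ k}`. -/
def tensorPow (k : ℕ) (A : Matrix ι ι ℂ) : Matrix (Fin k → ι) (Fin k → ι) ℂ :=
  Matrix.of fun x y => ∏ a, A (x a) (y a)

/-- `A^{⊗ k,k} = A^{⊗ k} ⊗ conj(A)^{⊗ k}`. -/
def tensorPowConj (k : ℕ) (A : Matrix ι ι ℂ) :
    Matrix ((Fin k → ι) × (Fin k → ι)) ((Fin k → ι) × (Fin k → ι)) ℂ :=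
  Matrix.kronecker (tensorPow k A) (tensorPow k (A.map star))

/-- The moment operator `∫ U^{⊗ k,k} dν(U)`, the integral being taken entrywise. -/
def momentOperator (k : ℕ) (ν : Measure (Matrix.unitaryGroup ι ℂ)) :
    Matrix ((Fin k → ι) × (Fin k → ι)) ((Fin k → ι) × (Fin k → ι)) ℂ :=
  Matrix.of fun x y => ∫ U, tensorPowConj k U.1 x y ∂ν

/-- The moment channel `X ↦ ∫ U^{⊗ k} X (U^†)^{⊗ k} dν(U)`, the integral being taken entrywise. -/
def momentChannel (k : ℕ) (ν : Measure (Matrix.unitaryGroup ι ℂ))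
    (X : Matrix (Fin k → ι) (Fin k → ι) ℂ) : Matrix (Fin k → ι) (Fin k → ι) ℂ :=
  Matrix.of fun x y => ∫ U, (tensorPow k U.1 * X * tensorPow k U.1ᴴ) x y ∂ν

end Moments

section Norms

variable {ι : Type*} [Fintype ι] [DecidableEq ι]

/-- Operator norm with respect to the Euclidean norm. -/
def opNorm (A : Matrix ι ι ℂ) : ℝ :=
  ‖Matrix.toEuclideanCLM (n := ι) (𝕜 := ℂ) A‖

/-- Trace norm `Tr √(A^† A)`. -/
def traceNorm (A : Matrix ι ι ℂ) : ℝ :=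
  ∑ i, √((Matrix.isHermitian_conjTranspose_mul_self A).eigenvalues i)

/-- `Φ ⊗ id_m` for a linear map `Φ` on matrices: `Φ` applied to each block. -/
def ampliate (Φ : Matrix ι ι ℂ → Matrix ι ι ℂ) (m : ℕ)
    (X : Matrix (ι × Fin m) (ι × Fin m) ℂ) : Matrix (ι × Fin m) (ι × Fin m) ℂ :=
  Matrix.of fun x y => Φ (Matrix.of fun a b => X (a, x.2) (b, y.2)) x.1 y.1

/-- Diamond norm of a linear map `Φ` on matrices: the supremum over all ancilla dimensions `m` of
the norm of `Φ ⊗ id_m` with respect to the trace norm. -/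
def diamondNorm (Φ : Matrix ι ι ℂ → Matrix ι ι ℂ) : ℝ≥0∞ :=
  ⨆ (m : ℕ) (X : Matrix (ι × Fin m) (ι × Fin m) ℂ) (_ : traceNorm X ≤ 1),
    ENNReal.ofReal (traceNorm (ampliate Φ m X))

end Norms

/-- `ν` is an `ε`-approximate unitary `k`-design on `n` qudits in the diamond-norm sense:
`‖Φ_ν - Φ_Haar‖_⋄ ≤ ε / q^{nk}`. -/
def IsDiamondApproxDesign {q n : ℕ} (k : ℕ) (ε : ℝ)
    (ν : Measure (Matrix.unitaryGroup (Config q n) ℂ)) : Prop :=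
  diamondNorm (fun X => momentChannel k ν X - momentChannel k (haar (Config q n)) X) ≤
    ENNReal.ofReal (ε / (q : ℝ) ^ (n * k))

/-- `ν` is an `ε`-approximate unitary `k`-design on `n` qudits in the operator-norm sense:
`‖M_ν - M_Haar‖_∞ ≤ ε / q^{2nk}`. -/
def IsOperatorApproxDesign {q n : ℕ} (k : ℕ) (ε : ℝ)
    (ν : Measure (Matrix.unitaryGroup (Config q n) ℂ)) : Prop :=
  opNorm (momentOperator k ν - momentOperator k (haar (Config q n))) ≤
    ε / (q : ℝ) ^ (2 * n * k)

/-- `∫_{U(q²)} U_{(i,j)}^{⊗ k,k} ⊗ 𝕀^{⊗ k,k} dμ_Haar(U)`: the local term of the moment operator at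
the edge `e`. -/
def localMoment (q k : ℕ) {n : ℕ} {G : SimpleGraph (Fin n)} (e : Edge G) :
    Matrix ((Fin k → Config q n) × (Fin k → Config q n))
      ((Fin k → Config q n) × (Fin k → Config q n)) ℂ :=
  Matrix.of fun x y =>
    ∫ U, tensorPowConj k (gate e.2.1.ne U).1 x y ∂(haar (Fin q × Fin q))

/-- The Hamiltonian `H(G, n, k)` for local dimension `q`. -/
def hamiltonian (q k : ℕ) {n : ℕ} (G : SimpleGraph (Fin n)) :
    Matrix ((Fin k → Config q n) × (Fin k → Config q n))
      ((Fin k → Config q n) × (Fin k → Config q n)) ℂ :=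
  ∑ e : Edge G, (1 - localMoment q k e)

/-- The smallest eigenvalue of a Hermitian matrix. -/
def groundEnergy {ι : Type*} [Fintype ι] [DecidableEq ι] (A : Matrix ι ι ℂ) : ℝ :=
  sInf (spectrum ℝ A)

/-- The difference between the two smallest distinct eigenvalues of a Hermitian matrix. -/
def spectralGap {ι : Type*} [Fintype ι] [DecidableEq ι] (A : Matrix ι ι ℂ) : ℝ :=
  sInf (spectrum ℝ A \ {groundEnergy A}) - groundEnergy A

/-- `Δ(CG, n, k)` for local dimension `q`: the spectral gap of `H(CG, n, k)`, where `CG` is the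
complete graph on `n` vertices. -/
def completeGraphGap (q n k : ℕ) : ℝ :=
  spectralGap (hamiltonian q k (⊤ : SimpleGraph (Fin n)))

end RQC

end

/-! For two copies, the Haar average of a gate on the edge `(i,j)` is the orthogonal projection P_ij
onto the span of the two permutation vectors (identity and swap) of the sites `i, j`, tensored with
the identity elsewhere (`momentOperator_haar`, `localMoment_eq`). Hence H is the sum over the edges
of 1 - P_ij. Its kernel is the span of the two global permutation vectors
(`permProj_mulVec_of_pairProj` gives the nontrivial inclusion).

Lower bound on the gap: it suffices to show H² ≥ γH as quadratic forms. Expanding H², the diagonal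
terms give H back, and disjoint edges contribute nonnegative terms because their projections
commute. Pairs of edges sharing a vertex are grouped into triangles. On a triangle with common
projection G, the relation PQP = (1 - α²)G + α²PS with α = q/(q²+1) (`pair_relation`) gives ‖(P -
G)(Q - G)‖ ≤ α. So the triangle Hamiltonian h satisfies h² ≥ (2 - 2α)h (`triangle_gap`), and its
cross terms are at least (1 - 2α)h. Each edge lies in n - 2 triangles, so γ = 1 + (1 - 2α)(n - 2)
works (`complete_graph_gap`, `hamiltonian_gap`).

Upper bound on the gap: put a vector orthogonal to both permutation vectors on one site and a fixed
permutation vector on all others. Exactly the n - 1 edges at that site contribute, each with energy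
1 (`sub_one_mem_spectrum_hamiltonian`).

Designs: moment operators turn convolution into multiplication, and one step has moment operator M =
1 - H/|E|. With G the Haar moment operator, ‖M^t - G‖ ≤ (1 - γ/|E|)^t (`opNorm_circuit_le`), which
yields the operator-norm statement. A superoperator on d × d matrices has diamond norm at most d
times the operator norm of its vectorized matrix (`diamondNorm_superOp_le`); here d = q^(2n),
exactly the ratio of the two required accuracies. -/

noncomputable section

namespace RQC

/-! ### Hilbert-space estimates for sums of projections: triangles and the complete graph. -/

section Projections

variable {E : Type*} [NormedAddCommGroup E] [InnerProductSpace ℂ E]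

theorem inner_comm_of_isSelfAdjoint [CompleteSpace E] {p : E →L[ℂ] E} (hp : IsSelfAdjoint p)
    (x y : E) : inner ℂ (p x) y = inner ℂ x (p y) := by
  conv_rhs => rw [← hp.adjoint_eq, ContinuousLinearMap.adjoint_inner_right]

theorem re_inner_proj_self [CompleteSpace E] {p : E →L[ℂ] E} (hp : IsStarProjection p) (x : E) :
    (inner ℂ x (p x)).re = ‖p x‖ ^ 2 := by
  have h : p (p x) = p x := congrArg (fun f : E →L[ℂ] E => f x) hp.isIdempotentElem.eq
  rw [← h, ← inner_comm_of_isSelfAdjoint hp.isSelfAdjoint, h,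
    inner_self_eq_norm_sq_to_K (𝕜 := ℂ)]
  norm_cast

theorem norm_proj_le [CompleteSpace E] {p : E →L[ℂ] E} (hp : IsStarProjection p) (x : E) :
    ‖p x‖ ≤ ‖x‖ := by
  have h1 := re_inner_proj_self hp x
  have h2 : (inner ℂ x (p x)).re ≤ ‖x‖ * ‖p x‖ := re_inner_le_norm (𝕜 := ℂ) x (p x)
  by_contra! h
  nlinarith [norm_nonneg x, norm_nonneg (p x)]

/-- Idempotency turns the inner product into that of `p x` with `p (q (q x))`, to which the
hypothesis applies at the vector `q x`; the arithmetic-geometric mean inequality finishes. -/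
theorem re_inner_proj_le [CompleteSpace E] {p q : E →L[ℂ] E} (hp : IsStarProjection p)
    (hq : IsStarProjection q) {α : ℝ} (hpq : ∀ x, ‖p (q x)‖ ≤ α * ‖x‖) (x : E) :
    (inner ℂ (p x) (q x)).re ≤ α * (‖p x‖ ^ 2 + ‖q x‖ ^ 2) / 2 := by
  have h1 : p (p x) = p x := congrArg (fun f : E →L[ℂ] E => f x) hp.isIdempotentElem.eq
  have h2 : q (q x) = q x := congrArg (fun f : E →L[ℂ] E => f x) hq.isIdempotentElem.eq
  have h3 : inner ℂ (p x) (q x) = inner ℂ (p x) (p (q (q x))) := by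
    rw [h2, ← inner_comm_of_isSelfAdjoint hp.isSelfAdjoint, h1]
  have h4 : (inner ℂ (p x) (p (q (q x)))).re ≤ ‖p x‖ * ‖p (q (q x))‖ :=
    re_inner_le_norm (𝕜 := ℂ) _ _
  have h5 := hpq (q x)
  rw [h3]
  have hα : 0 ≤ α * ‖q x‖ := (norm_nonneg _).trans h5
  -- The sign of `α` is not assumed: it is read off from `hpq` at a nonzero vector, which is `q x`
  -- or, if `q x = 0`, the vector `x` itself.
  rcases eq_or_lt_of_le (norm_nonneg (q x)) with h0 | h0
  · rw [← h0] at h5 ⊢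
    by_cases hx : x = 0
    · simp [hx]
    have : 0 ≤ α := by
      have := (norm_nonneg _).trans (hpq x)
      exact nonneg_of_mul_nonneg_left this (norm_pos_iff.2 hx)
    nlinarith [norm_nonneg (p x), norm_nonneg (p (q (q x))), sq_nonneg ‖p x‖,
      mul_nonneg this (sq_nonneg ‖p x‖)]
  · have : 0 ≤ α := nonneg_of_mul_nonneg_left hα h0
    nlinarith [norm_nonneg (p x), mul_le_mul_of_nonneg_left h5 (norm_nonneg (p x)),
      mul_nonneg this (sq_nonneg (‖p x‖ - ‖q x‖))]

/-- Three projections with pairwise products of norm at most `α` sum to at most `1 + 2 α`. -/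
theorem sum_sq_norm_proj_le [CompleteSpace E] {p q r : E →L[ℂ] E} (hp : IsStarProjection p)
    (hq : IsStarProjection q) (hr : IsStarProjection r) {α : ℝ} (hα : 0 ≤ α)
    (hpq : ∀ x, ‖p (q x)‖ ≤ α * ‖x‖) (hqr : ∀ x, ‖q (r x)‖ ≤ α * ‖x‖)
    (hpr : ∀ x, ‖p (r x)‖ ≤ α * ‖x‖) (x : E) :
    ‖p x‖ ^ 2 + ‖q x‖ ^ 2 + ‖r x‖ ^ 2 ≤ (1 + 2 * α) * ‖x‖ ^ 2 := by
  set s := ‖p x‖ ^ 2 + ‖q x‖ ^ 2 + ‖r x‖ ^ 2 with hs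
  -- Each squared norm enters two of the three cross terms, with weight `α` in each; hence `2 * α`.
  have h1 : ‖p x + q x + r x‖ ^ 2 ≤ (1 + 2 * α) * s := by
    have e1 := norm_add_sq (𝕜 := ℂ) (p x + q x) (r x)
    have e2 := norm_add_sq (𝕜 := ℂ) (p x) (q x)
    rw [inner_add_left, map_add] at e1
    simp only [RCLike.re_to_complex] at e1 e2
    have a1 := re_inner_proj_le hp hq hpq x
    have a2 := re_inner_proj_le hq hr hqr x
    have a3 := re_inner_proj_le hp hr hpr x
    nlinarith
  have h2 : s ≤ ‖x‖ * ‖p x + q x + r x‖ := by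
    have : (inner ℂ x (p x + q x + r x)).re = s := by
      rw [inner_add_right, inner_add_right, Complex.add_re, Complex.add_re,
        re_inner_proj_self hp, re_inner_proj_self hq, re_inner_proj_self hr]
    rw [← this]
    exact re_inner_le_norm (𝕜 := ℂ) _ _
  have hs0 : 0 ≤ s := by positivity
  have h3 : s ^ 2 ≤ ‖x‖ ^ 2 * ((1 + 2 * α) * s) := by
    calc s ^ 2 ≤ (‖x‖ * ‖p x + q x + r x‖) ^ 2 := by gcongr
      _ = ‖x‖ ^ 2 * ‖p x + q x + r x‖ ^ 2 := by ring
      _ ≤ _ := by gcongr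
  rcases eq_or_lt_of_le hs0 with h0 | h0
  · rw [← h0]; positivity
  · nlinarith

theorem IsStarProjection.sub_of_mul_eq {R : Type*} [Ring R] [StarRing R] {p g : R}
    (hp : IsStarProjection p) (hg : IsStarProjection g) (h : p * g = g) :
    IsStarProjection (p - g) := by
  have h' : g * p = g := by
    have := congrArg star h
    rwa [star_mul, hp.isSelfAdjoint.star_eq, hg.isSelfAdjoint.star_eq] at this
  refine ⟨?_, hp.isSelfAdjoint.sub hg.isSelfAdjoint⟩
  rw [IsIdempotentElem, sub_mul, mul_sub, mul_sub, h, h', hp.isIdempotentElem.eq,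
    hg.isIdempotentElem.eq]
  abel

/-- With h = (1 - p) + (1 - q) + (1 - r), this is h² ≥ (2 - 2α)h. On the complement of `g` the three
reduced projections sum to at most 1 + 2α, so h ≥ 3 - (1 + 2α) there, and h vanishes on the range of
`g`. -/
theorem triangle_gap [CompleteSpace E] {p q r g : E →L[ℂ] E} (hp : IsStarProjection p)
    (hq : IsStarProjection q) (hr : IsStarProjection r) (hg : IsStarProjection g)
    (hpg : p * g = g) (hqg : q * g = g) (hrg : r * g = g) {α : ℝ} (hα : 0 ≤ α) (hα1 : α < 1)
    (hpq : ∀ x, ‖(p - g) ((q - g) x)‖ ≤ α * ‖x‖) (hqr : ∀ x, ‖(q - g) ((r - g) x)‖ ≤ α * ‖x‖)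
    (hpr : ∀ x, ‖(p - g) ((r - g) x)‖ ≤ α * ‖x‖) (x : E) :
    (2 - 2 * α) * (‖(1 - p) x‖ ^ 2 + ‖(1 - q) x‖ ^ 2 + ‖(1 - r) x‖ ^ 2) ≤
      ‖(1 - p) x + (1 - q) x + (1 - r) x‖ ^ 2 := by
  have sp := IsStarProjection.sub_of_mul_eq hp hg hpg
  have sq := IsStarProjection.sub_of_mul_eq hq hg hqg
  have sr := IsStarProjection.sub_of_mul_eq hr hg hrg
  have key : ∀ {p : E →L[ℂ] E}, IsStarProjection p → p * g = g →
      (1 - p) x = (x - g x) - (p - g) (x - g x) ∧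
      ‖(1 - p) x‖ ^ 2 = ‖x - g x‖ ^ 2 - ‖(p - g) (x - g x)‖ ^ 2 := by
    intro p hp hpg
    have h1 : (1 - p) x = (x - g x) - (p - g) (x - g x) := by
      have a1 : p (g x) = g x := congrArg (fun f : E →L[ℂ] E => f x) hpg
      have a2 : g (g x) = g x := congrArg (fun f : E →L[ℂ] E => f x) hg.isIdempotentElem.eq
      simp [a1, a2]
    refine ⟨h1, ?_⟩
    have := norm_sub_sq (𝕜 := ℂ) (x - g x) ((p - g) (x - g x))
    rw [h1, this]
    have h2 := re_inner_proj_self (IsStarProjection.sub_of_mul_eq hp hg hpg) (x - g x)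
    simp only [RCLike.re_to_complex]
    rw [h2]; ring
  obtain ⟨p1, p2⟩ := key hp hpg
  obtain ⟨q1, q2⟩ := key hq hqg
  obtain ⟨r1, r2⟩ := key hr hrg
  set y := x - g x
  have hsum := sum_sq_norm_proj_le sp sq sr hα hpq hqr hpr y
  set z := (1 - p) x + (1 - q) x + (1 - r) x
  set s := ‖(1 - p) x‖ ^ 2 + ‖(1 - q) x‖ ^ 2 + ‖(1 - r) x‖ ^ 2 with hs
  have h1 : (2 - 2 * α) * ‖y‖ ^ 2 ≤ s := by rw [hs, p2, q2, r2]; nlinarith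
  -- Here `z` = h x = h y and `s` = ⟨y, h y⟩; Cauchy–Schwarz combined with `h1` eliminates `‖y‖`.
  have h2 : s ≤ ‖y‖ * ‖z‖ := by
    have : (inner ℂ y z).re = s := by
      simp only [z]
      rw [p1, q1, r1]
      simp only [inner_add_right, inner_sub_right, Complex.add_re, Complex.sub_re]
      rw [re_inner_proj_self sp, re_inner_proj_self sq, re_inner_proj_self sr,
        inner_self_eq_norm_sq_to_K (𝕜 := ℂ), hs, p2, q2, r2]
      norm_cast
    rw [← this]
    exact re_inner_le_norm (𝕜 := ℂ) _ _
  have hs0 : 0 ≤ s := by positivity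
  rcases eq_or_lt_of_le hs0 with h0 | h0
  · rw [← h0]; simp
  · have h3 : s ^ 2 ≤ ‖y‖ ^ 2 * ‖z‖ ^ 2 := by
      calc s ^ 2 ≤ (‖y‖ * ‖z‖) ^ 2 := by gcongr
        _ = _ := by ring
    have hd : 0 < 2 - 2 * α := by linarith
    have h4 : (2 - 2 * α) * s ^ 2 ≤ s * ‖z‖ ^ 2 := by
      nlinarith [mul_le_mul_of_nonneg_left h3 hd.le, sq_nonneg ‖z‖,
        mul_le_mul_of_nonneg_right h1 (sq_nonneg ‖z‖)]
    nlinarith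

/-- Local-to-global gap estimate on the complete graph: a triangle estimate with constant `κ`
improves to a constant growing linearly in the number of vertices. -/
theorem complete_graph_gap {ι : Type*} [Fintype ι] [DecidableEq ι] (v : ι → ι → E)
    (hsymm : ∀ i j, v i j = v j i) (hdiag : ∀ i, v i i = 0)
    (hdisj : ∀ i j k l, i ≠ j → k ≠ l → k ≠ i → k ≠ j → l ≠ i → l ≠ j →
      0 ≤ (inner ℂ (v i j) (v k l)).re) {κ : ℝ}
    (htri : ∀ i j k, i ≠ j → j ≠ k → i ≠ k →
      κ * (‖v i j‖ ^ 2 + ‖v j k‖ ^ 2 + ‖v k i‖ ^ 2) ≤ 2 * ((inner ℂ (v i j) (v j k)).re +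
        (inner ℂ (v j k) (v k i)).re + (inner ℂ (v k i) (v i j)).re)) :
    (2 + 2 * κ * ((Fintype.card ι : ℝ) - 2)) * ∑ i, ∑ j, ‖v i j‖ ^ 2 ≤
      ‖∑ i, ∑ j, v i j‖ ^ 2 := by
  classical
  -- `t` collects the inner products of edges meeting at `j`. All sums run over ordered pairs, so
  -- every edge is counted twice, which accounts for the factors 2 in the statement.
  set t : ι → ι → ι → ℝ := fun i j k =>
    if i ≠ j ∧ j ≠ k ∧ i ≠ k then (inner ℂ (v i j) (v j k)).re else 0 with ht
  set S : ℝ := ∑ i, ∑ j, ∑ k, t i j k with hS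
  set Q : ℝ := ∑ i, ∑ j, ‖v i j‖ ^ 2 with hQ
  have split : ∀ (f : ι → ℝ) {i j : ι}, i ≠ j →
      ∑ k, f k = f i + f j + ∑ k, if k ≠ i ∧ k ≠ j then f k else 0 := by
    intro f i j hij
    rw [← Finset.add_sum_erase _ f (Finset.mem_univ i),
      ← Finset.add_sum_erase _ f (Finset.mem_erase.2 ⟨hij.symm, Finset.mem_univ j⟩),
      ← Finset.sum_filter, add_assoc]
    congr 3
    ext k
    simp [and_comm]
  have hre : ∀ a b : E, (inner ℂ a b).re = (inner ℂ b a).re := fun a b =>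
    inner_re_symm (𝕜 := ℂ) a b
  have hcard : ∀ {i j : ι}, i ≠ j → ∀ a : ℝ,
      (∑ k, if i ≠ j ∧ j ≠ k ∧ i ≠ k then a else 0) = ((Fintype.card ι : ℝ) - 2) * a := by
    intro i j hij a
    have h := split (fun _ => a) hij
    simp only [Finset.sum_const, Finset.card_univ, nsmul_eq_mul] at h
    have e : (∑ k, if i ≠ j ∧ j ≠ k ∧ i ≠ k then a else 0) =
        ∑ k, if k ≠ i ∧ k ≠ j then a else 0 := by
      refine Finset.sum_congr rfl fun k _ => if_congr ?_ rfl rfl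
      constructor
      · rintro ⟨_, h1, h2⟩; exact ⟨h2.symm, h1.symm⟩
      · rintro ⟨h1, h2⟩; exact ⟨hij, h2.symm, h1.symm⟩
    rw [e]; linarith
  have hpairs : ∑ i, ∑ j, ∑ k, (if i ≠ j ∧ j ≠ k ∧ i ≠ k then ‖v i j‖ ^ 2 else 0) =
      ((Fintype.card ι : ℝ) - 2) * Q := by
    rw [hQ, Finset.mul_sum]
    refine Finset.sum_congr rfl fun i _ => ?_
    rw [Finset.mul_sum]
    refine Finset.sum_congr rfl fun j _ => ?_
    by_cases hij : i = j
    · subst hij; simp [hdiag]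
    · exact hcard hij _
  have hcyc : ∀ f : ι → ι → ι → ℝ, ∑ i, ∑ j, ∑ k, f j k i = ∑ i, ∑ j, ∑ k, f i j k := by
    intro f
    rw [Finset.sum_comm]
    exact Finset.sum_congr rfl fun j _ => Finset.sum_comm
  have htsum : κ * (((Fintype.card ι : ℝ) - 2) * Q) ≤ 2 * S := by
    set u : ι → ι → ι → ℝ := fun i j k =>
      if i ≠ j ∧ j ≠ k ∧ i ≠ k then ‖v i j‖ ^ 2 else 0 with hu
    -- Summing the triangle estimate over all ordered triples; cyclic relabelling makes the three
    -- sums on each side equal, and a common factor 3 cancels.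
    have h1 : ∑ i, ∑ j, ∑ k, κ * (u i j k + u j k i + u k i j) ≤
        ∑ i, ∑ j, ∑ k, 2 * (t i j k + t j k i + t k i j) := by
      refine Finset.sum_le_sum fun i _ => Finset.sum_le_sum fun j _ =>
        Finset.sum_le_sum fun k _ => ?_
      by_cases h : i ≠ j ∧ j ≠ k ∧ i ≠ k
      · have h' : j ≠ k ∧ k ≠ i ∧ j ≠ i := ⟨h.2.1, h.2.2.symm, h.1.symm⟩
        have h'' : k ≠ i ∧ i ≠ j ∧ k ≠ j := ⟨h.2.2.symm, h.1, h.2.1.symm⟩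
        simp only [hu, ht, if_pos h, if_pos h', if_pos h'']
        exact htri i j k h.1 h.2.1 h.2.2
      · have h' : ¬ (j ≠ k ∧ k ≠ i ∧ j ≠ i) := fun a => h ⟨a.2.2.symm, a.1, a.2.1.symm⟩
        have h'' : ¬ (k ≠ i ∧ i ≠ j ∧ k ≠ j) := fun a => h ⟨a.2.1, a.2.2.symm, a.1.symm⟩
        simp only [hu, ht, if_neg h, if_neg h', if_neg h'']
        simp
    simp only [← Finset.mul_sum, Finset.sum_add_distrib] at h1
    rw [hcyc u, hcyc t, ← hcyc (fun i j k => u k i j), ← hcyc (fun i j k => t k i j), hpairs] at h1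
    linarith
  have hnorm : ‖∑ i, ∑ j, v i j‖ ^ 2 = ∑ i, ∑ j, ∑ k, ∑ l, (inner ℂ (v i j) (v k l)).re := by
    have := inner_self_eq_norm_sq_to_K (𝕜 := ℂ) (∑ i, ∑ j, v i j)
    have h2 : ‖∑ i, ∑ j, v i j‖ ^ 2 =
        (inner ℂ (∑ i, ∑ j, v i j) (∑ i, ∑ j, v i j)).re := by
      rw [this]; norm_cast
    rw [h2]
    simp only [sum_inner, inner_sum, Complex.re_sum]
    exact Finset.sum_congr rfl fun i _ => Finset.sum_congr rfl fun j _ =>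
      Finset.sum_congr rfl fun k _ => Finset.sum_congr rfl fun l _ => hre _ _
  -- For fixed `(i, j)`, the pairs `(i, j)` and `(j, i)` give the squared norms, pairs sharing
  -- exactly one vertex give the `t` terms, and disjoint pairs are dropped as nonnegative.
  have hpt : ∀ i j, 2 * ‖v i j‖ ^ 2 + 2 * (∑ k, t i j k + ∑ k, t j i k) ≤
      ∑ k, ∑ l, (inner ℂ (v i j) (v k l)).re := by
    intro i j
    by_cases hij : i = j
    · subst hij; simp [hdiag, ht]
    set F : ι → ι → ℝ := fun k l => (inner ℂ (v i j) (v k l)).re with hF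
    have hFs : ∀ k l, F k l = F l k := fun k l => by simp only [hF]; rw [hsymm k l]
    have hFd : ∀ k, F k k = 0 := fun k => by simp [hF, hdiag]
    have e1 : F i j = ‖v i j‖ ^ 2 := by
      simp only [hF]; rw [inner_self_eq_norm_sq_to_K (𝕜 := ℂ)]; norm_cast
    have e2 : ∑ k, t i j k = ∑ k, if k ≠ i ∧ k ≠ j then F j k else 0 := by
      refine Finset.sum_congr rfl fun k _ => if_congr ?_ rfl rfl
      constructor
      · rintro ⟨_, h1, h2⟩; exact ⟨h2.symm, h1.symm⟩
      · rintro ⟨h1, h2⟩; exact ⟨hij, h2.symm, h1.symm⟩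
    have e3 : ∑ k, t j i k = ∑ k, if k ≠ i ∧ k ≠ j then F i k else 0 := by
      refine Finset.sum_congr rfl fun k _ => ?_
      simp only [ht, hF]
      rw [hsymm j i]
      refine if_congr ?_ rfl rfl
      constructor
      · rintro ⟨_, h1, h2⟩; exact ⟨h1.symm, h2.symm⟩
      · rintro ⟨h1, h2⟩; exact ⟨fun h => hij h.symm, h1.symm, h2.symm⟩
    have e4 : ∑ k, ∑ l, F k l = 2 * F i j + 2 * (∑ k, t i j k + ∑ k, t j i k) +
        ∑ k, if k ≠ i ∧ k ≠ j then (∑ l, if l ≠ i ∧ l ≠ j then F k l else 0) else 0 := by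
      have a : ∀ k, ∑ l, F k l = F k i + F k j + ∑ l, if l ≠ i ∧ l ≠ j then F k l else 0 :=
        fun k => split (F k) hij
      rw [split (fun k => ∑ l, F k l) hij]
      simp only [a]
      have b : (∑ k, if k ≠ i ∧ k ≠ j then
          F k i + F k j + (∑ l, if l ≠ i ∧ l ≠ j then F k l else 0) else 0) =
          (∑ k, if k ≠ i ∧ k ≠ j then F i k else 0) + (∑ k, if k ≠ i ∧ k ≠ j then F j k else 0) +
          ∑ k, if k ≠ i ∧ k ≠ j then (∑ l, if l ≠ i ∧ l ≠ j then F k l else 0) else 0 := by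
        rw [← Finset.sum_add_distrib, ← Finset.sum_add_distrib]
        refine Finset.sum_congr rfl fun k _ => ?_
        split_ifs
        · rw [hFs k i, hFs k j]
        · simp
      rw [b, e2, e3, hFd, hFd, hFs j i]
      ring
    rw [e4, e1]
    refine le_add_of_nonneg_right (Finset.sum_nonneg fun k _ => ?_)
    split_ifs with hk
    · refine Finset.sum_nonneg fun l _ => ?_
      split_ifs with hl
      · by_cases hkl : k = l
        · subst hkl; rw [hFd]
        · exact hdisj i j k l hij hkl hk.1 hk.2 hl.1 hl.2
      · exact le_rfl
    · exact le_rfl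
  have hfin : 2 * Q + 4 * S ≤ ∑ i, ∑ j, ∑ k, ∑ l, (inner ℂ (v i j) (v k l)).re := by
    have h1 := Finset.sum_le_sum fun i (_ : i ∈ Finset.univ) =>
      Finset.sum_le_sum fun j (_ : j ∈ Finset.univ) => hpt i j
    simp only [← Finset.mul_sum, Finset.sum_add_distrib] at h1
    have h2 : ∑ i, ∑ j, ∑ k, t j i k = S := by rw [hS, Finset.sum_comm]
    rw [h2] at h1
    linarith
  rw [hnorm]
  nlinarith

end Projections

/-! ### Algebra of the operators |σ_s⟩⟨σ_t| on sites, and the relation between adjacent pair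
projections. -/

section SiteAlgebra

/-- Gram matrix of the two permutation vectors of a system of dimension `d`. -/
def gram (d : ℝ) (s t : Bool) : ℂ := if s = t then (d : ℂ) ^ 2 else d

/-- Inverse of the Gram matrix: the Weingarten function for `k = 2`. -/
def wg (d : ℝ) (s t : Bool) : ℂ :=
  if s = t then ((d : ℂ) ^ 2 - 1)⁻¹ else -((d : ℂ) * ((d : ℂ) ^ 2 - 1))⁻¹

theorem wg_symm (d : ℝ) (s t : Bool) : wg d s t = wg d t s := by
  simp only [wg, eq_comm]

theorem star_wg (d : ℝ) (s t : Bool) : star (wg d s t) = wg d s t := by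
  unfold wg
  split_ifs <;> simp

theorem sq_sub_one_ne_zero {d : ℝ} (hd : 1 < d) : (d : ℂ) ^ 2 - 1 ≠ 0 := by
  have : d ^ 2 - 1 ≠ 0 := by nlinarith
  exact_mod_cast this

theorem sum_wg_mul_gram {d : ℝ} (hd : 1 < d) (s r : Bool) :
    ∑ t, wg d s t * gram d t r = if s = r then 1 else 0 := by
  have h0 : (d : ℂ) ≠ 0 := by exact_mod_cast (by linarith : d ≠ 0)
  have h1 := sq_sub_one_ne_zero hd
  cases s <;> cases r <;> simp [wg, gram] <;> field_simp <;> ring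

variable {R : Type*} [Ring R] [StarRing R] [Algebra ℂ R]

/-- `e s t` multiplies and conjugates like the operators `|σ_s⟩⟨σ_t|` built from two vectors with
Gram matrix `gram d`. -/
structure IsSite (d : ℝ) (e : Bool → Bool → R) : Prop where
  mul : ∀ s t s' t', e s t * e s' t' = gram d t s' • e s t'
  star : ∀ s t, star (e s t) = e t s

/-- The orthogonal projection onto the span of the two vectors underlying `e`. -/
def spanProj (d : ℝ) (e : Bool → Bool → R) : R := ∑ s, ∑ t, wg d s t • e s t

theorem IsSite.pair {d d' : ℝ} {e f : Bool → Bool → R} (he : IsSite d e) (hf : IsSite d' f)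
    (h : ∀ s t s' t', Commute (e s t) (f s' t')) :
    IsSite (d * d') (fun s t => e s t * f s t) := by
  refine ⟨fun s t s' t' => ?_, fun s t => ?_⟩
  · have : e s t * f s t * (e s' t' * f s' t') = (e s t * e s' t') * (f s t * f s' t') := by
      rw [mul_assoc, ← mul_assoc (f s t), ← (h s' t' s t).eq]; simp only [mul_assoc]
    rw [this, he.mul, hf.mul, smul_mul_smul_comm]
    congr 1
    unfold gram
    split_ifs <;> push_cast <;> ring
  · rw [star_mul, he.star, hf.star, (h _ _ _ _).eq]

theorem IsSite.spanProj_mul {d : ℝ} (hd : 1 < d) {e : Bool → Bool → R} (he : IsSite d e)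
    (s t : Bool) : spanProj d e * e s t = e s t := by
  have : spanProj d e * e s t = ∑ a, (∑ b, wg d a b * gram d b s) • e a t := by
    simp only [spanProj, Finset.sum_mul, Finset.sum_smul, smul_mul_assoc, he.mul, smul_smul]
  rw [this]
  simp only [sum_wg_mul_gram hd, ite_smul, one_smul, zero_smul, Finset.sum_ite_eq',
    Finset.mem_univ, if_true]

theorem IsSite.isStarProjection [StarModule ℂ R] {d : ℝ} (hd : 1 < d) {e : Bool → Bool → R} (he : IsSite d e) :
    IsStarProjection (spanProj d e) := by
  constructor
  · rw [IsIdempotentElem]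
    nth_rewrite 2 [spanProj]
    simp only [Finset.mul_sum, mul_smul_comm, he.spanProj_mul hd]
    rfl
  · rw [isSelfAdjoint_iff, spanProj]
    simp only [star_sum, star_smul, star_wg, he.star]
    rw [Finset.sum_comm]
    exact Finset.sum_congr rfl fun s _ => Finset.sum_congr rfl fun t _ => by rw [wg_symm]

/-- Temperley–Lieb type relation between two pair projections sharing a site. -/
theorem pair_relation {q : ℝ} (hq : 1 < q) {e f g : Bool → Bool → R} (he : IsSite q e)
    (hf : IsSite q f) (hef : ∀ s t s' t', Commute (e s t) (f s' t'))
    (heg : ∀ s t s' t', Commute (e s t) (g s' t'))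
    (hfg : ∀ s t s' t', Commute (f s t) (g s' t')) :
    spanProj (q ^ 2) (fun s t => e s t * f s t) * spanProj (q ^ 2) (fun s t => f s t * g s t) *
        spanProj (q ^ 2) (fun s t => e s t * f s t) =
      (1 - ((q : ℂ) / (q ^ 2 + 1)) ^ 2) • spanProj (q ^ 3) (fun s t => e s t * f s t * g s t) +
      (((q : ℂ) / (q ^ 2 + 1)) ^ 2) •
        (spanProj (q ^ 2) (fun s t => e s t * f s t) * spanProj q g) := by
  -- Both sides are combinations of the sixteen products `e a b * f a b * g c d`, and coefficients
  -- are compared. On the left, contracting the first site gives `gram q t u`; the shared site is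
  -- contracted twice and gives `gram q t c * gram q d u`.
  set C : Bool → Bool → Bool → Bool → ℂ := fun a b c d =>
    ∑ t, ∑ u, wg (q ^ 2) a t * wg (q ^ 2) c d * wg (q ^ 2) u b *
      (gram q t u * (gram q t c * gram q d u)) with hC
  have hL : spanProj (q ^ 2) (fun s t => e s t * f s t) *
      spanProj (q ^ 2) (fun s t => f s t * g s t) *
        spanProj (q ^ 2) (fun s t => e s t * f s t) =
      ∑ a, ∑ b, ∑ c, ∑ d, C a b c d • (e a b * f a b * g c d) := by
    have hm : ∀ a t c d u b, e a t * f a t * (f c d * g c d) * (e u b * f u b) =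
        (gram q t u * (gram q t c * gram q d u)) • (e a b * f a b * g c d) := by
      intro a t c d u b
      have : e a t * f a t * (f c d * g c d) * (e u b * f u b) =
          (e a t * e u b) * ((f a t * f c d) * f u b) * g c d := by
        calc _ = e a t * f a t * f c d * (g c d * (e u b * f u b)) := by simp only [mul_assoc]
          _ = e a t * f a t * f c d * ((e u b * f u b) * g c d) := by
            rw [((heg u b c d).mul_left (hfg u b c d)).eq]
          _ = e a t * ((f a t * f c d) * e u b) * f u b * g c d := by simp only [mul_assoc]
          _ = e a t * (e u b * (f a t * f c d)) * f u b * g c d := by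
            rw [((hef u b a t).mul_right (hef u b c d)).eq]
          _ = _ := by simp only [mul_assoc]
      rw [this, he.mul, hf.mul, smul_mul_assoc (gram q t c), hf.mul, smul_smul,
        smul_mul_smul_comm, smul_mul_assoc]
    simp only [spanProj, Finset.sum_mul, Finset.mul_sum, smul_mul_assoc, mul_smul_comm, hm,
      smul_smul, hC, Finset.sum_smul]
    simp only [Fintype.sum_bool]
    module
  have hR : (1 - ((q : ℂ) / (q ^ 2 + 1)) ^ 2) •
        spanProj (q ^ 3) (fun s t => e s t * f s t * g s t) +
      (((q : ℂ) / (q ^ 2 + 1)) ^ 2) •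
        (spanProj (q ^ 2) (fun s t => e s t * f s t) * spanProj q g) =
      ∑ a, ∑ b, ∑ c, ∑ d, ((1 - ((q : ℂ) / (q ^ 2 + 1)) ^ 2) *
        (if a = c ∧ b = d then wg (q ^ 3) a b else 0) +
        ((q : ℂ) / (q ^ 2 + 1)) ^ 2 * (wg (q ^ 2) a b * wg q c d)) •
          (e a b * f a b * g c d) := by
    simp only [spanProj, Finset.sum_mul, Finset.mul_sum, smul_mul_assoc, mul_smul_comm]
    simp only [Fintype.sum_bool, reduceCtorEq, and_true, and_false, if_true,
      if_false]
    module
  rw [hL, hR]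
  have h0 : (q : ℂ) ≠ 0 := by exact_mod_cast (by linarith : q ≠ 0)
  have h1 : (q : ℂ) ^ 2 - 1 ≠ 0 := sq_sub_one_ne_zero hq
  have h2 : (q : ℂ) ^ 2 + 1 ≠ 0 := by
    have : q ^ 2 + 1 ≠ 0 := by positivity
    exact_mod_cast this
  have h4 : (q : ℂ) ^ 4 - 1 ≠ 0 := by
    have := sq_sub_one_ne_zero (one_lt_pow₀ hq two_ne_zero)
    push_cast at this
    rwa [← pow_mul] at this
  have h6 : (q : ℂ) ^ 6 - 1 ≠ 0 := by
    have := sq_sub_one_ne_zero (one_lt_pow₀ hq three_ne_zero)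
    push_cast at this
    rwa [← pow_mul] at this
  refine Finset.sum_congr rfl fun a _ => Finset.sum_congr rfl fun b _ =>
    Finset.sum_congr rfl fun c _ => Finset.sum_congr rfl fun d _ => ?_
  congr 1
  simp only [hC, Fintype.sum_bool, wg, gram]
  push_cast
  simp only [← pow_mul, Nat.reduceMul]
  cases a <;> cases b <;> cases c <;> cases d <;> simp <;> field_simp <;> ring

end SiteAlgebra

/-! ### Pair and triple projections, and the gap inequality for commuting sites. -/

section SiteGap

variable {R : Type*} [Ring R] [Algebra ℂ R]

/-- The projection onto the span of the two doubled vectors on a pair of sites. -/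
def pairProj (q : ℝ) (e f : Bool → Bool → R) : R := spanProj (q ^ 2) fun s t => e s t * f s t

/-- The projection onto the span of the two tripled vectors on three sites. -/
def tripleProj (q : ℝ) (e f g : Bool → Bool → R) : R :=
  spanProj (q ^ 3) fun s t => e s t * f s t * g s t

theorem pairProj_comm {q : ℝ} {e f : Bool → Bool → R}
    (h : ∀ s t s' t', Commute (e s t) (f s' t')) : pairProj q e f = pairProj q f e := by
  simp only [pairProj]
  congr 1
  funext s t
  exact (h s t s t).eq

theorem spanProj_commute {d d' : ℝ} {e f : Bool → Bool → R}
    (h : ∀ s t s' t', Commute (e s t) (f s' t')) : Commute (spanProj d e) (spanProj d' f) := by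
  refine Commute.sum_left _ _ _ fun s _ => Commute.sum_left _ _ _ fun t _ =>
    Commute.sum_right _ _ _ fun s' _ => Commute.sum_right _ _ _ fun t' _ => ?_
  exact ((h s t s' t').smul_left _).smul_right _

theorem tripleProj_rotate {q : ℝ} {e f g : Bool → Bool → R}
    (hef : ∀ s t s' t', Commute (e s t) (f s' t'))
    (heg : ∀ s t s' t', Commute (e s t) (g s' t')) :
    tripleProj q f g e = tripleProj q e f g := by
  simp only [tripleProj]
  congr 1
  funext s t
  rw [mul_assoc (e s t), ((hef s t s t).mul_right (heg s t s t)).eq]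

theorem tripleProj_swap {q : ℝ} {e f g : Bool → Bool → R}
    (hef : ∀ s t s' t', Commute (e s t) (f s' t')) :
    tripleProj q f e g = tripleProj q e f g := by
  simp only [tripleProj]
  congr 1
  funext s t
  rw [(hef s t s t).eq]

variable [StarRing R]

theorem isSite_triple {q : ℝ} {e f g : Bool → Bool → R} (he : IsSite q e) (hf : IsSite q f)
    (hg : IsSite q g) (hef : ∀ s t s' t', Commute (e s t) (f s' t'))
    (heg : ∀ s t s' t', Commute (e s t) (g s' t'))
    (hfg : ∀ s t s' t', Commute (f s t) (g s' t')) :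
    IsSite (q ^ 3) fun s t => e s t * f s t * g s t := by
  have := (he.pair hf hef).pair hg fun s t s' t' => (heg s t s' t').mul_left (hfg s t s' t')
  rwa [show q * q * q = q ^ 3 by ring] at this

/-- Multiplying a tripled site by a projection fixing the doubled part leaves it unchanged. -/
theorem spanProj_mul_spanProj_mul {d d' : ℝ} (hd : 1 < d) {e g : Bool → Bool → R}
    (he : IsSite d e) :
    spanProj d e * spanProj d' (fun s t => e s t * g s t) =
      spanProj d' (fun s t => e s t * g s t) := by
  nth_rewrite 2 [spanProj]
  simp only [Finset.mul_sum, mul_smul_comm, ← mul_assoc, he.spanProj_mul hd]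
  rfl

theorem pairProj_mul_tripleProj {q : ℝ} (hq : 1 < q) {e f g : Bool → Bool → R}
    (he : IsSite q e) (hf : IsSite q f) (hef : ∀ s t s' t', Commute (e s t) (f s' t')) :
    pairProj q e f * tripleProj q e f g = tripleProj q e f g := by
  have := he.pair hf hef
  rw [← sq] at this
  exact spanProj_mul_spanProj_mul (one_lt_pow₀ hq two_ne_zero) this

theorem isStarProjection_pairProj [StarModule ℂ R] {q : ℝ} (hq : 1 < q) {e f : Bool → Bool → R}
    (he : IsSite q e) (hf : IsSite q f) (h : ∀ s t s' t', Commute (e s t) (f s' t')) :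
    IsStarProjection (pairProj q e f) := by
  have := he.pair hf h
  rw [← sq] at this
  exact this.isStarProjection (one_lt_pow₀ hq two_ne_zero)

end SiteGap

section SiteGapHilbert

variable {E : Type*} [NormedAddCommGroup E] [InnerProductSpace ℂ E] [CompleteSpace E]

/-- By `pair_relation`, (P - G)(Q - G)(P - G) = PQP - G = α²(PS - G) with α = q/(q²+1). Since P and
S commute and both fix G, PS - G is a projection, so ‖(Q - G)(P - G)x‖² ≤ α²‖x‖². -/
theorem norm_pairProj_sub_le {q : ℝ} (hq : 1 < q) {e f g : Bool → Bool → (E →L[ℂ] E)}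
    (he : IsSite q e) (hf : IsSite q f) (hg : IsSite q g)
    (hef : ∀ s t s' t', Commute (e s t) (f s' t'))
    (heg : ∀ s t s' t', Commute (e s t) (g s' t'))
    (hfg : ∀ s t s' t', Commute (f s t) (g s' t')) (x : E) :
    ‖(pairProj q f g - tripleProj q e f g) ((pairProj q e f - tripleProj q e f g) x)‖ ≤
      q / (q ^ 2 + 1) * ‖x‖ := by
  set P := pairProj q e f
  set Q := pairProj q f g
  set G := tripleProj q e f g
  set S := spanProj q g
  have hP : IsStarProjection P := isStarProjection_pairProj hq he hf hef
  have hQ : IsStarProjection Q := isStarProjection_pairProj hq hf hg hfg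
  have hG : IsStarProjection G :=
    (isSite_triple he hf hg hef heg hfg).isStarProjection (one_lt_pow₀ hq three_ne_zero)
  have hS : IsStarProjection S := hg.isStarProjection hq
  have hPG : P * G = G := pairProj_mul_tripleProj hq he hf hef
  have hQG : Q * G = G := by
    have := pairProj_mul_tripleProj (g := e) hq hf hg hfg
    rwa [tripleProj_rotate hef heg] at this
  have hSG : S * G = G := by
    have h1 : G = spanProj (q ^ 3) fun s t => g s t * (e s t * f s t) := by
      simp only [G, tripleProj]
      congr 1
      funext s t
      exact ((heg s t s t).mul_left (hfg s t s t)).eq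
    rw [h1]
    exact spanProj_mul_spanProj_mul hq hg
  have star_eq : ∀ {A : E →L[ℂ] E}, IsStarProjection A → A * G = G → G * A = G := by
    intro A hA h
    have := congrArg star h
    rwa [star_mul, hA.isSelfAdjoint.star_eq, hG.isSelfAdjoint.star_eq] at this
  have hGP := star_eq hP hPG
  have hGQ := star_eq hQ hQG
  have hPS : Commute P S := spanProj_commute fun s t s' t' =>
    (heg s t s' t').mul_left (hfg s t s' t')
  have hT : IsStarProjection (P * S) :=
    ⟨by
      rw [IsIdempotentElem, mul_assoc, ← mul_assoc S P, ← hPS.eq, mul_assoc P S S,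
        hS.isIdempotentElem.eq, ← mul_assoc, hP.isIdempotentElem.eq], by
      rw [isSelfAdjoint_iff, star_mul, hP.isSelfAdjoint.star_eq, hS.isSelfAdjoint.star_eq,
        hPS.eq]⟩
  have hTG : P * S * G = G := by rw [mul_assoc, hSG, hPG]
  have hrel : (P - G) * (Q - G) * (P - G) =
      (((q : ℂ) / (q ^ 2 + 1)) ^ 2) • (P * S - G) := by
    have h1 : P * Q * P = (1 - ((q : ℂ) / (q ^ 2 + 1)) ^ 2) • G +
        (((q : ℂ) / (q ^ 2 + 1)) ^ 2) • (P * S) := pair_relation hq he hf hef heg hfg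
    have h2 : (P - G) * (Q - G) * (P - G) = P * Q * P - G := by
      have hGG := hG.isIdempotentElem.eq
      simp only [sub_mul, mul_sub, hPG, hGQ, hGG, hGP]
      rw [mul_assoc P Q G, hQG, hPG]
      abel
    rw [h2, h1]
    module
  have hPG' := IsStarProjection.sub_of_mul_eq hP hG hPG
  have hQG' := IsStarProjection.sub_of_mul_eq hQ hG hQG
  have hT' := IsStarProjection.sub_of_mul_eq hT hG hTG
  have hsq : ‖(Q - G) ((P - G) x)‖ ^ 2 ≤ (q / (q ^ 2 + 1) * ‖x‖) ^ 2 := by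
    rw [← re_inner_proj_self hQG', inner_comm_of_isSelfAdjoint hPG'.isSelfAdjoint]
    have : (P - G) ((Q - G) ((P - G) x)) =
        (((q : ℂ) / (q ^ 2 + 1)) ^ 2) • (P * S - G) x :=
      congrArg (fun f : E →L[ℂ] E => f x) hrel
    rw [this, inner_smul_right]
    have hc : ((q : ℂ) / (q ^ 2 + 1)) ^ 2 = (((q / (q ^ 2 + 1)) ^ 2 : ℝ) : ℂ) := by push_cast; rfl
    rw [hc, Complex.re_ofReal_mul, re_inner_proj_self hT', mul_pow]
    gcongr
    exact norm_proj_le hT' x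
  exact (sq_le_sq₀ (norm_nonneg _) (by positivity)).1 hsq

/-- `complete_graph_gap` with κ = 1 - 2α: `triangle_gap` bounds squares plus cross terms below by (2
- 2α) times the squares, which leaves (1 - 2α) for the cross terms. -/
theorem sites_gap {q : ℝ} (hq : 1 < q) {ι : Type*} [Fintype ι] [DecidableEq ι]
    {e : ι → Bool → Bool → (E →L[ℂ] E)} (he : ∀ i, IsSite q (e i))
    (hc : ∀ i j, i ≠ j → ∀ s t s' t', Commute (e i s t) (e j s' t')) (x : E) :
    (2 + 2 * (1 - 2 * q / (q ^ 2 + 1)) * ((Fintype.card ι : ℝ) - 2)) *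
      ∑ i, ∑ j, ‖if i = j then 0 else (1 - pairProj q (e i) (e j)) x‖ ^ 2 ≤
      ‖∑ i, ∑ j, if i = j then 0 else (1 - pairProj q (e i) (e j)) x‖ ^ 2 := by
  have hα0 : 0 ≤ q / (q ^ 2 + 1) := by positivity
  have hα1 : q / (q ^ 2 + 1) < 1 := by rw [div_lt_one (by positivity)]; nlinarith
  have hproj : ∀ i j, i ≠ j → IsStarProjection (pairProj q (e i) (e j)) := fun i j h =>
    isStarProjection_pairProj hq (he i) (he j) (hc i j h)
  refine complete_graph_gap (fun i j => if i = j then 0 else (1 - pairProj q (e i) (e j)) x)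
    ?_ ?_ ?_ ?_
  · intro i j
    by_cases h : i = j
    · simp [h]
    · simp only [if_neg h, if_neg (Ne.symm h)]
      rw [pairProj_comm (hc i j h)]
  · intro i; simp
  · intro i j k l hij hkl hki hkj hli hlj
    simp only [if_neg hij, if_neg hkl]
    -- For disjoint edges the product of the two commuting projections is again a projection, so the
    -- cross term is a squared norm.
    have hcm : Commute (1 - pairProj q (e i) (e j)) (1 - pairProj q (e k) (e l)) := by
      have : Commute (pairProj q (e i) (e j)) (pairProj q (e k) (e l)) :=
        spanProj_commute fun s t s' t' =>
          ((hc i k hki.symm _ _ _ _).mul_right (hc i l hli.symm _ _ _ _)).mul_left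
            ((hc j k hkj.symm _ _ _ _).mul_right (hc j l hlj.symm _ _ _ _))
      exact (Commute.one_left _).sub_left ((Commute.one_right _).sub_right this)
    have h1 := (hproj i j hij).one_sub
    have h2 := (hproj k l hkl).one_sub
    set A := 1 - pairProj q (e i) (e j)
    set B := 1 - pairProj q (e k) (e l)
    have h3 : IsStarProjection (A * B) :=
      ⟨by
        rw [IsIdempotentElem, mul_assoc, ← mul_assoc B A, ← hcm.eq, mul_assoc A B B,
          h2.isIdempotentElem.eq, ← mul_assoc, h1.isIdempotentElem.eq], by
        rw [isSelfAdjoint_iff, star_mul, h1.isSelfAdjoint.star_eq, h2.isSelfAdjoint.star_eq,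
          hcm.eq]⟩
    rw [inner_comm_of_isSelfAdjoint h1.isSelfAdjoint]
    have := re_inner_proj_self h3 x
    rw [mul_apply_eq_comp] at this
    rw [this]
    positivity
  · intro i j k hij hjk hik
    simp only [if_neg hij, if_neg hjk, if_neg (Ne.symm hik)]
    have hG : IsStarProjection (tripleProj q (e i) (e j) (e k)) :=
      (isSite_triple (he i) (he j) (he k) (hc i j hij) (hc i k hik) (hc j k hjk)).isStarProjection
        (one_lt_pow₀ hq three_ne_zero)
    have r1 : tripleProj q (e j) (e k) (e i) = tripleProj q (e i) (e j) (e k) :=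
      tripleProj_rotate (hc i j hij) (hc i k hik)
    have r2 : tripleProj q (e k) (e i) (e j) = tripleProj q (e i) (e j) (e k) := by
      rw [← r1, tripleProj_rotate (hc j k hjk) (hc j i hij.symm)]
    have g1 := pairProj_mul_tripleProj (g := e k) hq (he i) (he j) (hc i j hij)
    have g2 := pairProj_mul_tripleProj (g := e i) hq (he j) (he k) (hc j k hjk)
    have g3 := pairProj_mul_tripleProj (g := e j) hq (he k) (he i) (hc k i hik.symm)
    have n1 := norm_pairProj_sub_le hq (he i) (he j) (he k) (hc i j hij) (hc i k hik) (hc j k hjk)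
    have n2 := norm_pairProj_sub_le hq (he j) (he k) (he i) (hc j k hjk) (hc j i hij.symm)
      (hc k i hik.symm)
    have n3 := norm_pairProj_sub_le hq (he k) (he i) (he j) (hc k i hik.symm) (hc k j hjk.symm)
      (hc i j hij)
    rw [r1] at g2 n2
    rw [r2] at g3 n3
    have key := triangle_gap (hproj k i hik.symm) (hproj j k hjk) (hproj i j hij) hG g3 g2 g1
      hα0 hα1 n2 n1 (fun x => ?_) x
    · set a := (1 - pairProj q (e k) (e i)) x
      set b := (1 - pairProj q (e j) (e k)) x
      set c := (1 - pairProj q (e i) (e j)) x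
      have e1 := norm_add_sq (𝕜 := ℂ) (a + b) c
      have e2 := norm_add_sq (𝕜 := ℂ) a b
      rw [inner_add_left, map_add] at e1
      simp only [RCLike.re_to_complex] at e1 e2
      have s1 : (inner ℂ c b).re = (inner ℂ b c).re := inner_re_symm (𝕜 := ℂ) _ _
      have s2 : (inner ℂ b a).re = (inner ℂ a b).re := inner_re_symm (𝕜 := ℂ) _ _
      rw [s1, s2]
      have : 2 * q / (q ^ 2 + 1) = 2 * (q / (q ^ 2 + 1)) := by ring
      rw [this]
      nlinarith
    -- The remaining product has the order opposite to the cyclic pattern, so the estimate is taken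
    -- along the path `j, i, k` and rewritten by symmetry of the projections.
    · have n4 := norm_pairProj_sub_le hq (he j) (he i) (he k) (hc j i hij.symm) (hc j k hjk)
        (hc i k hik) x
      rw [tripleProj_swap (hc i j hij), pairProj_comm (hc i k hik),
        pairProj_comm (hc j i hij.symm)] at n4
      exact n4

end SiteGapHilbert

/-! ### The two permutation vectors of a single system. -/

section PermutationVectors

/-- Indices of the fourfold tensor power `ℂ^D ⊗ ℂ^D ⊗ conj ℂ^D ⊗ conj ℂ^D`. -/
abbrev MomentIdx (D : Type*) : Type _ := (Fin 2 → D) × (Fin 2 → D)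

/-- The two permutations of `Fin 2`. -/
def permOf (s : Bool) : Equiv.Perm (Fin 2) := if s then Equiv.swap 0 1 else 1

/-- The vectorized permutation operator on `ℂ^D ⊗ ℂ^D`. -/
def permVec (D : Type*) [DecidableEq D] (s : Bool) (x : MomentIdx D) : ℂ :=
  if x.1 = x.2 ∘ permOf s then 1 else 0

theorem permVec_false {D : Type*} [DecidableEq D] (x : MomentIdx D) :
    permVec D false x = if x.1 0 = x.2 0 ∧ x.1 1 = x.2 1 then 1 else 0 := by
  simp [permVec, permOf, funext_iff, Fin.forall_fin_two]

theorem permVec_true {D : Type*} [DecidableEq D] (x : MomentIdx D) :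
    permVec D true x = if x.1 0 = x.2 1 ∧ x.1 1 = x.2 0 then 1 else 0 := by
  simp [permVec, permOf, funext_iff, Fin.forall_fin_two]

theorem star_permVec {D : Type*} [DecidableEq D] (s : Bool) :
    star (permVec D s) = permVec D s := by
  funext x
  simp only [Pi.star_apply, permVec]
  split_ifs <;> simp

variable {D : Type*} [Fintype D] [DecidableEq D]

/-- The inner product counts the pairs `y` on which the two permutations agree: all d² pairs if they
coincide, only the d pairs with equal entries otherwise. -/
theorem permVec_dotProduct (s t : Bool) :
    permVec D s ⬝ᵥ permVec D t = gram (Fintype.card D) s t := by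
  have h1 : permVec D s ⬝ᵥ permVec D t =
      ∑ y : Fin 2 → D, if y ∘ permOf s = y ∘ permOf t then (1 : ℂ) else 0 := by
    simp only [dotProduct, permVec, Fintype.sum_prod_type]
    rw [Finset.sum_comm]
    refine Finset.sum_congr rfl fun y _ => ?_
    simp [eq_comm]
  rw [h1]
  by_cases hst : s = t
  · subst hst
    simp [gram]
  · have h2 : ∀ y : Fin 2 → D, (y ∘ permOf s = y ∘ permOf t) ↔ y 0 = y 1 := by
      intro y
      cases s <;> cases t <;> simp_all [permOf, funext_iff, Fin.forall_fin_two, eq_comm]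
    simp only [h2, gram, if_neg hst]
    rw [← (finTwoArrowEquiv D).symm.sum_comp]
    rw [Fintype.sum_prod_type]
    simp

variable (D) in
/-- The rank-one operator built from two permutation vectors. -/
def permMat (s t : Bool) : Matrix (MomentIdx D) (MomentIdx D) ℂ :=
  Matrix.vecMulVec (permVec D s) (permVec D t)

theorem isSite_permMat : IsSite (Fintype.card D : ℝ) (permMat D) := by
  refine ⟨fun s t s' t' => ?_, fun s t => ?_⟩
  · rw [permMat, permMat, Matrix.vecMulVec_mul_vecMulVec, permVec_dotProduct]
    simp [permMat, Matrix.vecMulVec_smul]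
  · rw [permMat, Matrix.star_eq_conjTranspose, Matrix.conjTranspose_vecMulVec, star_permVec,
      star_permVec, permMat]

variable (D) in
/-- The orthogonal projection onto the span of the two permutation vectors. -/
def permProj : Matrix (MomentIdx D) (MomentIdx D) ℂ := spanProj (Fintype.card D : ℝ) (permMat D)

theorem permProj_mulVec_permVec (hD : 1 < Fintype.card D) (s : Bool) :
    permProj D *ᵥ permVec D s = permVec D s := by
  have h := (isSite_permMat (D := D)).spanProj_mul (by exact_mod_cast hD) s s
  have hne : (gram (Fintype.card D) s s : ℂ) ≠ 0 := by
    simp only [gram, if_true]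
    exact pow_ne_zero _ (by exact_mod_cast (by omega))
  have h2 := congrArg (· *ᵥ permVec D s) h
  simp only [← Matrix.mulVec_mulVec] at h2
  have h3 : permMat D s s *ᵥ permVec D s = gram (Fintype.card D) s s • permVec D s := by
    rw [permMat, Matrix.vecMulVec_mulVec, permVec_dotProduct]
    simp
  rw [h3, Matrix.mulVec_smul] at h2
  exact smul_right_injective _ hne h2

theorem isStarProjection_permProj (hD : 1 < Fintype.card D) :
    IsStarProjection (permProj D) :=
  isSite_permMat.isStarProjection (by exact_mod_cast hD)

end PermutationVectors

/-! ### Product operators on many sites. -/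

section TensorOperators

variable {ι F : Type*} [Fintype ι] [DecidableEq ι] [Fintype F] [DecidableEq F]

/-- Regrouping the tensor factors by sites. -/
def locEquiv (ι F : Type*) : MomentIdx (ι → F) ≃ (ι → MomentIdx F) where
  toFun x l := (fun a => x.1 a l, fun a => x.2 a l)
  invFun y := (fun a l => (y l).1 a, fun a l => (y l).2 a)
  left_inv _ := rfl
  right_inv _ := rfl

/-- The tensor product of single-site operators. -/
def piOp : (ι → Matrix (MomentIdx F) (MomentIdx F) ℂ) →*
    Matrix (MomentIdx (ι → F)) (MomentIdx (ι → F)) ℂ where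
  toFun A := Matrix.of fun x y => ∏ l, A l (locEquiv ι F x l) (locEquiv ι F y l)
  map_one' := by
    ext x y
    simp only [Matrix.of_apply, Pi.one_apply, Matrix.one_apply]
    rw [Fintype.prod_ite_zero]
    simp [← funext_iff]
  map_mul' A B := by
    ext x y
    simp only [Matrix.of_apply, Pi.mul_apply, Matrix.mul_apply]
    rw [Finset.prod_univ_sum, Fintype.piFinset_univ, ← (locEquiv ι F).sum_comp]
    exact Finset.sum_congr rfl fun z _ => Finset.prod_mul_distrib

theorem piOp_apply (A : ι → Matrix (MomentIdx F) (MomentIdx F) ℂ) (x y : MomentIdx (ι → F)) :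
    piOp A x y = ∏ l, A l (locEquiv ι F x l) (locEquiv ι F y l) := rfl

theorem piOp_conjTranspose (A : ι → Matrix (MomentIdx F) (MomentIdx F) ℂ) :
    (piOp A)ᴴ = piOp fun l => (A l)ᴴ := by
  ext x y
  simp [piOp_apply, Matrix.conjTranspose_apply]

theorem piOp_eq_zero {A : ι → Matrix (MomentIdx F) (MomentIdx F) ℂ} {l : ι} (h : A l = 0) :
    piOp A = 0 := by
  ext x y
  rw [piOp_apply, Matrix.zero_apply]
  exact Finset.prod_eq_zero (Finset.mem_univ l) (by rw [h, Matrix.zero_apply])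

theorem piOp_mulSingle_smul (l : ι) (c : ℂ) (A : Matrix (MomentIdx F) (MomentIdx F) ℂ) :
    piOp (Pi.mulSingle l (c • A)) = c • piOp (Pi.mulSingle l A) := by
  ext x y
  rw [Matrix.smul_apply, piOp_apply, piOp_apply, Fintype.prod_eq_mul_prod_compl l,
    Fintype.prod_eq_mul_prod_compl l]
  simp only [Pi.mulSingle_eq_same, Matrix.smul_apply, smul_eq_mul, mul_assoc]
  congr 2
  refine Finset.prod_congr rfl fun l' hl' => ?_
  have : l' ≠ l := by simpa using hl'
  rw [Pi.mulSingle_eq_of_ne this, Pi.mulSingle_eq_of_ne this]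

/-- The operators `|σ_s⟩⟨σ_t|` acting on the site `l`. -/
def siteOp (l : ι) (s t : Bool) : Matrix (MomentIdx (ι → F)) (MomentIdx (ι → F)) ℂ :=
  piOp (Pi.mulSingle l (permMat F s t))

theorem isSite_siteOp (l : ι) : IsSite (Fintype.card F : ℝ) (siteOp (F := F) l) := by
  refine ⟨fun s t s' t' => ?_, fun s t => ?_⟩
  · rw [siteOp, siteOp, ← map_mul, ← Pi.mulSingle_mul, isSite_permMat.mul, piOp_mulSingle_smul]
    rfl
  · rw [siteOp, Matrix.star_eq_conjTranspose, piOp_conjTranspose, siteOp]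
    congr 1
    funext l'
    by_cases h : l' = l
    · subst h
      rw [Pi.mulSingle_eq_same, Pi.mulSingle_eq_same, ← Matrix.star_eq_conjTranspose,
        isSite_permMat.star]
    · rw [Pi.mulSingle_eq_of_ne h, Pi.mulSingle_eq_of_ne h, Matrix.conjTranspose_one]

theorem siteOp_commute {i j : ι} (h : i ≠ j) (s t s' t' : Bool) :
    Commute (siteOp (F := F) i s t) (siteOp j s' t') :=
  (Pi.mulSingle_commute h _ _).map piOp

/-- Permuting the two copies acts on every site simultaneously, so a global permutation vector is
the product of the local ones. -/
theorem permVec_pi {ι F : Type*} [Fintype ι] [DecidableEq F] (s : Bool) (x : MomentIdx (ι → F)) :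
    permVec (ι → F) s x = ∏ l, permVec F s (locEquiv ι F x l) := by
  simp only [permVec]
  rw [Fintype.prod_ite_zero]
  simp only [Finset.prod_const_one]
  refine if_congr ?_ rfl rfl
  simp only [funext_iff, locEquiv, Equiv.coe_fn_mk, Function.comp]
  exact forall_comm

theorem siteOp_mul_apply {i j : ι} (hij : i ≠ j) (s t : Bool) (x y : MomentIdx (ι → F)) :
    (siteOp i s t * siteOp j s t : Matrix (MomentIdx (ι → F)) _ ℂ) x y =
      if ∀ l, l ≠ i → l ≠ j → locEquiv ι F x l = locEquiv ι F y l then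
        permVec F s (locEquiv ι F x i) * permVec F s (locEquiv ι F x j) *
        (permVec F t (locEquiv ι F y i) * permVec F t (locEquiv ι F y j)) else 0 := by
  rw [siteOp, siteOp, ← map_mul, piOp_apply]
  rw [← Finset.mul_prod_erase _ _ (Finset.mem_univ i),
    ← Finset.mul_prod_erase _ _ (Finset.mem_erase.2 ⟨hij.symm, Finset.mem_univ j⟩)]
  simp only [Pi.mul_apply, Pi.mulSingle_eq_same, Pi.mulSingle_eq_of_ne hij,
    Pi.mulSingle_eq_of_ne hij.symm, mul_one, one_mul]
  have h1 : ∏ l ∈ (Finset.univ.erase i).erase j, ((Pi.mulSingle i (permMat F s t) : ι → _) l *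
      (Pi.mulSingle j (permMat F s t) : ι → _) l) (locEquiv ι F x l) (locEquiv ι F y l) =
      if ∀ l, l ≠ i → l ≠ j → locEquiv ι F x l = locEquiv ι F y l then (1 : ℂ) else 0 := by
    have h2 : ∀ l ∈ (Finset.univ.erase i).erase j, ((Pi.mulSingle i (permMat F s t) : ι → _) l *
      (Pi.mulSingle j (permMat F s t) : ι → _) l) (locEquiv ι F x l) (locEquiv ι F y l) =
        if locEquiv ι F x l = locEquiv ι F y l then (1 : ℂ) else 0 := by
      intro l hl
      simp only [Finset.mem_erase, Finset.mem_univ, and_true] at hl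
      rw [Pi.mulSingle_eq_of_ne hl.1, Pi.mulSingle_eq_of_ne hl.2, mul_one, Matrix.one_apply]
    rw [Finset.prod_congr rfl h2, Finset.prod_ite_zero]
    simp only [Finset.prod_const_one, Finset.mem_erase, Finset.mem_univ, and_true]
    exact if_congr ⟨fun h l a b => h l ⟨b, a⟩, fun h l a => h l a.2 a.1⟩ rfl rfl
  rw [h1]
  simp only [permMat, Matrix.vecMulVec_apply]
  split_ifs
  · ring
  · ring

end TensorOperators

/-! ### The common fixed space of all pair projections. -/

section CommonKernel

variable {ι F : Type*} [Fintype ι] [DecidableEq ι] [Fintype F] [DecidableEq F]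

/-- Evaluation at `p s` is a functional dual to the permutation vectors. It gives oblique
projections onto products of permutation vectors that need no inverse Gram matrix. -/
theorem exists_dual_points (hF : 1 < Fintype.card F) :
    ∃ p : Bool → MomentIdx F, ∀ s t, permVec F t (p s) = if s = t then 1 else 0 := by
  obtain ⟨a, b, hab⟩ := Fintype.one_lt_card_iff.1 hF
  refine ⟨fun s => (![a, b], if s then ![b, a] else ![a, b]), fun s t => ?_⟩
  cases s <;> cases t <;> simp [permVec_false, permVec_true, hab, hab.symm]

/-- A vector fixed by all pair projections lies in the span of the global permutation vectors. -/
theorem permProj_mulVec_of_pairProj (hF : 1 < Fintype.card F) (hι : 1 < Fintype.card ι)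
    (v : MomentIdx (ι → F) → ℂ)
    (hv : ∀ i j, i ≠ j →
      pairProj (Fintype.card F : ℝ) (siteOp (F := F) i) (siteOp j) *ᵥ v = v) :
    permProj (ι → F) *ᵥ v = v := by
  obtain ⟨p, hp⟩ := exists_dual_points hF
  -- `N s` = |σ_s⟩⟨p_s| are mutually annihilating oblique idempotents. `K T` below sums their
  -- products over `T`: it projects obliquely onto vectors that carry the same permutation at all
  -- sites of `T`.
  set N : Bool → Matrix (MomentIdx F) (MomentIdx F) ℂ := fun s =>
    Matrix.vecMulVec (permVec F s) (Pi.single (p s) 1) with hN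
  have hNN : ∀ s s', N s * N s' = if s = s' then N s else 0 := by
    intro s s'
    simp only [hN]
    rw [Matrix.vecMulVec_mul_vecMulVec, single_dotProduct, hp]
    split_ifs with h
    · subst h; simp
    · simp
  have hNM : ∀ s s' t, N s * permMat F s' t = if s = s' then permMat F s t else 0 := by
    intro s s' t
    simp only [hN, permMat]
    rw [Matrix.vecMulVec_mul_vecMulVec, single_dotProduct, hp]
    split_ifs with h
    · subst h; simp
    · simp
  set K : Finset ι → Matrix (MomentIdx (ι → F)) (MomentIdx (ι → F)) ℂ := fun T =>
    ∑ s, piOp fun l => if l ∈ T then N s else 1 with hK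
  have hpair : ∀ i j, i ≠ j → K {i, j} *ᵥ v = v := by
    intro i j hij
    rw [← hv i j hij, Matrix.mulVec_mulVec]
    congr 1
    simp only [hK, pairProj, spanProj, Finset.mul_sum, Finset.sum_mul, Matrix.mul_smul]
    have h1 : ∀ s s' t, (piOp fun l => if l ∈ ({i, j} : Finset ι) then N s else 1) *
        (siteOp i s' t * siteOp j s' t) =
        if s = s' then siteOp i s' t * siteOp j s' t else 0 := by
      intro s s' t
      simp only [siteOp, ← map_mul]
      split_ifs with h
      · subst h
        congr 1
        funext l
        by_cases hi : l = i
        · subst hi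
          simp [hij, hNM]
        · by_cases hj : l = j
          · subst hj
            simp [hi, hNM]
          · simp [hi, hj]
      · refine piOp_eq_zero (l := i) ?_
        simp [hij, hNM, h]
    simp only [h1, smul_ite, smul_zero, Finset.sum_ite_eq', Finset.mem_univ, if_true]
  -- The shared site `j` forces the two permutation labels to agree, so `v`, fixed by every `K {j,
  -- k}`, is fixed by `K T` for growing `T`.
  have hstep : ∀ (T : Finset ι) (j k : ι), j ∈ T → k ∉ T → K T * K {j, k} = K (insert k T) := by
    intro T j k hj hk
    have hjk : j ≠ k := fun h => hk (h ▸ hj)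
    simp only [hK, Finset.mul_sum, Finset.sum_mul]
    have h1 : ∀ s s', (piOp fun l => if l ∈ T then N s else 1) *
        (piOp fun l => if l ∈ ({j, k} : Finset ι) then N s' else 1) =
        if s = s' then piOp fun l => if l ∈ insert k T then N s else 1 else 0 := by
      intro s s'
      rw [← map_mul]
      split_ifs with h
      · subst h
        congr 1
        funext l
        by_cases hlk : l = k
        · subst hlk
          simp [hk]
        · by_cases hlj : l = j
          · subst hlj
            simp [hj, hNN]
          · simp [hlk, hlj]
      · refine piOp_eq_zero (l := j) ?_
        simp [hj, hNN, h]
    simp only [h1, Finset.sum_ite_eq', Finset.mem_univ, if_true]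
  obtain ⟨i₀, i₁, h01⟩ := Fintype.one_lt_card_iff.1 hι
  have hall : ∀ T : Finset ι, K (T ∪ {i₀, i₁}) *ᵥ v = v := by
    intro T
    induction T using Finset.induction_on with
    | empty => simpa using hpair i₀ i₁ h01
    | insert k T _ ih =>
      by_cases hk : k ∈ T ∪ {i₀, i₁}
      · rwa [Finset.insert_union, Finset.insert_eq_of_mem hk]
      · have hi : i₀ ∈ T ∪ {i₀, i₁} := by simp
        have hne : i₀ ≠ k := fun h => hk (h ▸ hi)
        rw [Finset.insert_union, ← hstep _ i₀ k hi hk, ← Matrix.mulVec_mulVec, hpair i₀ k hne, ih]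
  have huniv : K Finset.univ *ᵥ v = v := by
    have := hall Finset.univ
    rwa [Finset.union_eq_left.2 (Finset.subset_univ _)] at this
  have hcard : 1 < Fintype.card (ι → F) := by
    rw [Fintype.card_fun]
    exact Nat.one_lt_pow (by omega) hF
  -- Once `T` contains all sites, each summand has rank one with range spanned by a global
  -- permutation vector.
  have hvec : ∀ s, (piOp fun l : ι => if l ∈ Finset.univ then N s else 1) =
      Matrix.vecMulVec (permVec (ι → F) s)
        (fun y => ∏ l, (Pi.single (p s) 1 : MomentIdx F → ℂ) (locEquiv ι F y l)) := by
    intro s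
    ext x y
    rw [piOp_apply, Matrix.vecMulVec_apply, permVec_pi, ← Finset.prod_mul_distrib]
    simp [hN, Matrix.vecMulVec_apply]
  rw [← huniv, Matrix.mulVec_mulVec]
  congr 1
  simp only [hK, Finset.mul_sum]
  refine Finset.sum_congr rfl fun s _ => ?_
  rw [hvec, Matrix.mul_vecMulVec, permProj_mulVec_permVec hcard]

end CommonKernel

/-! ### Unitary invariance of the permutation vectors. -/

section TensorPowers

variable {D : Type*}

theorem tensorPow_mul [Fintype D] (k : ℕ) (A B : Matrix D D ℂ) :
    tensorPow k (A * B) = tensorPow k A * tensorPow k B := by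
  ext x y
  simp only [tensorPow, Matrix.of_apply, Matrix.mul_apply]
  rw [Finset.prod_univ_sum, Fintype.piFinset_univ]
  exact Finset.sum_congr rfl fun z _ => Finset.prod_mul_distrib

theorem tensorPowConj_mul [Fintype D] (k : ℕ) (A B : Matrix D D ℂ) :
    tensorPowConj k (A * B) = tensorPowConj k A * tensorPowConj k B := by
  have h : (A * B).map star = A.map star * B.map star :=
    Matrix.map_mul (f := starRingEnd ℂ)
  rw [tensorPowConj, h, tensorPow_mul, tensorPow_mul, tensorPowConj, tensorPowConj]
  exact Matrix.mul_kronecker_mul _ _ _ _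

theorem tensorPowConj_star (k : ℕ) (A : Matrix D D ℂ) :
    tensorPowConj k (star A) = star (tensorPowConj k A) := by
  ext x y
  simp [tensorPowConj, tensorPow, Matrix.kroneckerMap_apply, Matrix.star_apply]

theorem tensorPowConj_one [DecidableEq D] (k : ℕ) : tensorPowConj k (1 : Matrix D D ℂ) = 1 := by
  have h : tensorPow k (1 : Matrix D D ℂ) = 1 := by
    ext x y
    simp only [tensorPow, Matrix.of_apply, Matrix.one_apply, Fintype.prod_ite_zero,
      Finset.prod_const_one, funext_iff]
  have h' : (1 : Matrix D D ℂ).map star = 1 := Matrix.map_one _ (star_zero _) (star_one _)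
  rw [tensorPowConj, h', h]
  exact Matrix.one_kronecker_one

variable [Fintype D] [DecidableEq D]

/-- The vectorized form of the fact that permuting tensor factors commutes with U ⊗ U; after
matching factors through the permutation it is orthonormality of the rows of `U`. -/
theorem tensorPowConj_mulVec_permVec {U : Matrix D D ℂ} (hU : U ∈ Matrix.unitaryGroup D ℂ)
    (s : Bool) : tensorPowConj 2 U *ᵥ permVec D s = permVec D s := by
  funext x
  have h1 : (tensorPowConj 2 U *ᵥ permVec D s) x = ∑ y : Fin 2 → D,
      ∏ a, (U (x.1 ((permOf s).symm a)) (y a) * star (U (x.2 a) (y a))) := by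
    simp only [Matrix.mulVec, dotProduct, Fintype.sum_prod_type, permVec]
    rw [Finset.sum_comm]
    refine Finset.sum_congr rfl fun y _ => ?_
    simp only [mul_ite, mul_one, mul_zero, Finset.sum_ite_eq', Finset.mem_univ, if_true]
    simp only [tensorPowConj, tensorPow, Matrix.kronecker, Matrix.kroneckerMap_apply,
      Matrix.of_apply, Matrix.map_apply]
    rw [Finset.prod_mul_distrib]
    congr 1
    exact Fintype.prod_equiv (permOf s) _ _ (by simp)
  have h2 : ∀ a b, ∑ z, U a z * star (U b z) = if a = b then 1 else 0 := by
    intro a b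
    have := congrFun (congrFun (Matrix.mem_unitaryGroup_iff.1 hU) a) b
    rwa [Matrix.mul_apply, Matrix.one_apply] at this
  have h3 := Finset.prod_univ_sum (fun _ : Fin 2 => (Finset.univ : Finset D))
    (fun a z => U (x.1 ((permOf s).symm a)) z * star (U (x.2 a) z))
  rw [Fintype.piFinset_univ] at h3
  rw [h1, ← h3]
  simp only [h2, Fintype.prod_ite_zero, Finset.prod_const_one, permVec]
  refine if_congr ?_ rfl rfl
  constructor
  · intro h
    funext a
    have := h (permOf s a)
    simpa using this
  · intro h a
    rw [h]
    simp

theorem tensorPowConj_mul_permProj {U : Matrix D D ℂ} (hU : U ∈ Matrix.unitaryGroup D ℂ) :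
    tensorPowConj 2 U * permProj D = permProj D := by
  simp only [permProj, spanProj, Finset.mul_sum, Matrix.mul_smul, permMat, Matrix.mul_vecMulVec,
    tensorPowConj_mulVec_permVec hU]

theorem permProj_mul_tensorPowConj (hD : 1 < Fintype.card D) {U : Matrix D D ℂ}
    (hU : U ∈ Matrix.unitaryGroup D ℂ) : permProj D * tensorPowConj 2 U = permProj D := by
  have h := congrArg star (tensorPowConj_mul_permProj (Unitary.star_mem hU))
  rwa [star_mul, tensorPowConj_star, star_star,
    (isStarProjection_permProj hD).isSelfAdjoint.star_eq] at h

end TensorPowers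

/-! ### Elementary invariant theory: all invariants of U ⊗ U ⊗ conj U ⊗ conj U. -/

section Invariants

variable {D : Type*} [Fintype D] [DecidableEq D]

theorem tensorPowConj_two_mulVec {D : Type*} [Fintype D] (A : Matrix D D ℂ) (w : MomentIdx D → ℂ) (a b c d : D) :
    (tensorPowConj 2 A *ᵥ w) (![a, b], ![c, d]) =
      ∑ a', ∑ b', ∑ c', ∑ d', A a a' * A b b' * (star (A c c') * star (A d d')) *
        w (![a', b'], ![c', d']) := by
  have h : ∀ f : (Fin 2 → D) → ℂ, ∑ y, f y = ∑ a', ∑ b', f ![a', b'] := by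
    intro f
    rw [← (finTwoArrowEquiv D).symm.sum_comp, Fintype.sum_prod_type]
    rfl
  simp only [Matrix.mulVec, dotProduct, Fintype.sum_prod_type, h]
  simp [tensorPowConj, tensorPow, Matrix.kroneckerMap_apply, Fin.prod_univ_two]

/-- Invariant vectors of `U ⊗ U ⊗ conj U ⊗ conj U` are spanned by the permutation vectors. -/
theorem exists_eq_sum_permVec (hD : 1 < Fintype.card D) (w : MomentIdx D → ℂ)
    (hw : ∀ U ∈ Matrix.unitaryGroup D ℂ, tensorPowConj 2 U *ᵥ w = w) :
    ∃ c : Bool → ℂ, w = ∑ s, c s • permVec D s := by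
  set W : D → D → D → D → ℂ := fun a b c d => w (![a, b], ![c, d]) with hW
  have hinv : ∀ U ∈ Matrix.unitaryGroup D ℂ, ∀ a b c d,
      ∑ a', ∑ b', ∑ c', ∑ d', U a a' * U b b' * (star (U c c') * star (U d d')) *
        W a' b' c' d' = W a b c d := by
    intro U hU a b c d
    rw [← tensorPowConj_two_mulVec, hw U hU]
  have hdiag : ∀ u : D → ℂ, (∀ a, u a * star (u a) = 1) → ∀ a b c d, W a b c d ≠ 0 →
      u a * u b * (star (u c) * star (u d)) = 1 := by
    intro u hu a b c d h0
    have hU : Matrix.diagonal u ∈ Matrix.unitaryGroup D ℂ := by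
      rw [Matrix.mem_unitaryGroup_iff, Matrix.star_eq_conjTranspose, Matrix.diagonal_conjTranspose,
        Matrix.diagonal_mul_diagonal, ← Matrix.diagonal_one]
      congr 1
      funext a
      exact hu a
    have h := hinv _ hU a b c d
    simp only [Matrix.diagonal_apply, apply_ite star, star_zero, mul_ite, ite_mul, zero_mul,
      mul_zero, Finset.sum_ite_eq, Finset.mem_univ, if_true] at h
    exact mul_right_cancel₀ h0 (h.trans (one_mul _).symm)
  -- The phase i at a single label `z` compares the multiplicities of `z` in (a,b) and in (c,d)
  -- modulo 4. They are at most 2, so they agree on the support of `W`; a sign -1 would not separate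
  -- 0 from 2.
  have hphase : ∀ z a b c d, W a b c d ≠ 0 →
      (if a = z then Complex.I else 1) * (if b = z then Complex.I else 1) *
        ((if c = z then -Complex.I else 1) * (if d = z then -Complex.I else 1)) = 1 := by
    intro z a b c d h0
    have h := hdiag (fun a => if a = z then Complex.I else 1)
      (fun a => by split_ifs <;> simp) a b c d h0
    simpa only [apply_ite star, Complex.star_def, Complex.conj_I, map_one] using h
  have hsupp : ∀ a b c d, ¬ (a = c ∧ b = d) → ¬ (a = d ∧ b = c) → W a b c d = 0 := by
    intro a b c d h1 h2
    by_contra h0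
    have ha := hphase a a b c d h0
    have hb := hphase b a b c d h0
    have hI : Complex.I ≠ 1 := fun h => by simpa using congrArg Complex.re h
    by_cases hab : b = a
    · subst hab
      by_cases hc : c = b
      · have hd : d ≠ b := fun h => h1 ⟨hc.symm, h.symm⟩
        simp [hc, hd] at ha
        exact hI ha
      · by_cases hd : d = b
        · simp [hc, hd] at ha
          exact hI ha
        · simp only [if_true, if_neg hc, if_neg hd, mul_one, Complex.I_mul_I] at ha
          norm_num at ha
    · have hab' : a ≠ b := Ne.symm hab
      simp only [if_true, if_neg hab, if_neg hab', mul_one, one_mul] at ha hb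
      by_cases hc : c = a
      · have hd : d ≠ b := fun h => h1 ⟨hc.symm, h.symm⟩
        have hc' : c ≠ b := hc ▸ hab'
        simp only [if_neg hc', if_neg hd, mul_one] at hb
        exact hI hb
      · by_cases hd : d = a
        · have hcb : c ≠ b := fun h => h2 ⟨hd.symm, h.symm⟩
          have hd' : d ≠ b := hd ▸ hab'
          simp only [if_neg hcb, if_neg hd', mul_one] at hb
          exact hI hb
        · simp only [if_neg hc, if_neg hd, mul_one] at ha
          exact hI ha
  -- Permutation matrices act 2-transitively on labels, so only the three values at patterns aaaa,
  -- abab and abba remain.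
  have hperm : ∀ (τ : Equiv.Perm D) a b c d, W (τ a) (τ b) (τ c) (τ d) = W a b c d := by
    intro τ a b c d
    have hU : (Matrix.of fun a b : D => if τ a = b then (1 : ℂ) else 0) ∈
        Matrix.unitaryGroup D ℂ := by
      rw [Matrix.mem_unitaryGroup_iff]
      ext a b
      simp [Matrix.mul_apply, Matrix.one_apply, Matrix.star_apply, eq_comm]
    rw [← hinv _ hU a b c d]
    simp [apply_ite star]
  have htrans : ∀ a b a' b' : D, a ≠ b → a' ≠ b' → ∃ τ : Equiv.Perm D, τ a = a' ∧ τ b = b' := by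
    intro a b a' b' h h'
    refine ⟨(Equiv.swap a a').trans (Equiv.swap (Equiv.swap a a' b) b'), ?_, ?_⟩
    · rw [Equiv.trans_apply, Equiv.swap_apply_left]
      refine Equiv.swap_apply_of_ne_of_ne (fun h1 => h ?_) h'
      have : Equiv.swap a a' a = Equiv.swap a a' b := by rw [Equiv.swap_apply_left, ← h1]
      exact (Equiv.swap a a').injective this
    · rw [Equiv.trans_apply, Equiv.swap_apply_left]
  obtain ⟨a₀, b₀, h₀⟩ := Fintype.one_lt_card_iff.1 hD
  -- One unitary mixing two labels gives the last relation: the reflection along u = (1, 2), whose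
  -- row at `a₀` is the rational pair (3/5, -4/5).
  have hrot : W a₀ a₀ a₀ a₀ = W a₀ b₀ a₀ b₀ + W a₀ b₀ b₀ a₀ := by
    set u : D → ℂ := fun a => (if a = a₀ then 1 else 0) + if a = b₀ then 2 else 0 with hu
    have huu : ∑ z, u z * u z = 5 := by
      simp only [hu, add_mul, mul_add, ite_mul, mul_ite, Finset.sum_add_distrib, zero_mul, mul_zero]
      simp [h₀, h₀.symm]
      norm_num
    have hstar : ∀ a, star (u a) = u a := by
      intro a
      simp only [hu, star_add]
      split_ifs <;> simp
    set U : Matrix D D ℂ := Matrix.of fun a b => (if a = b then 1 else 0) - 2 / 5 * (u a * u b)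
      with hUdef
    have hs : star U = U := by
      ext a b
      rw [Matrix.star_apply]
      simp only [hUdef, Matrix.of_apply, star_sub, star_mul', hstar]
      have : star (2 / 5 : ℂ) = 2 / 5 := by simp
      rw [this, apply_ite star, star_one, star_zero, mul_comm (u b)]
      simp only [eq_comm]
    have hU : U ∈ Matrix.unitaryGroup D ℂ := by
      rw [Matrix.mem_unitaryGroup_iff, hs]
      ext a b
      rw [Matrix.mul_apply, Matrix.one_apply]
      simp only [hUdef, Matrix.of_apply]
      have e : ∀ z, ((if a = z then (1 : ℂ) else 0) - 2 / 5 * (u a * u z)) *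
          ((if z = b then 1 else 0) - 2 / 5 * (u z * u b)) =
          (if a = z then (if z = b then 1 else 0) - 2 / 5 * (u z * u b) else 0) -
          (if z = b then 2 / 5 * (u a * u z) else 0) + 4 / 25 * (u a * u b) * (u z * u z) := by
        intro z
        split_ifs <;> ring
      simp only [e, Finset.sum_add_distrib, Finset.sum_sub_distrib, ← Finset.mul_sum, huu,
        Finset.sum_ite_eq, Finset.sum_ite_eq', Finset.mem_univ, if_true]
      ring
    have hrow : ∀ z, U a₀ z = (if z = a₀ then 3 / 5 else 0) + if z = b₀ then -4 / 5 else 0 := by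
      intro z
      simp only [hUdef, Matrix.of_apply, hu, if_true, if_neg h₀]
      by_cases h1 : z = a₀
      · subst h1; simp [h₀]; norm_num
      · by_cases h2 : z = b₀
        · subst h2; simp [h₀, h₀.symm]; norm_num
        · simp [h1, h2, Ne.symm h1]
    have hsum : ∀ f : D → ℂ, ∑ z, U a₀ z * f z = 3 / 5 * f a₀ - 4 / 5 * f b₀ := by
      intro f
      simp only [hrow, add_mul, ite_mul, zero_mul, Finset.sum_add_distrib, Finset.sum_ite_eq',
        Finset.mem_univ, if_true]
      ring
    have hsum' : ∀ f : D → ℂ, ∑ z, star (U a₀ z) * f z = 3 / 5 * f a₀ - 4 / 5 * f b₀ := by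
      intro f
      rw [← hsum]
      refine Finset.sum_congr rfl fun z _ => ?_
      rw [hrow, star_add, apply_ite star, apply_ite star]
      simp
    have h : ∑ a', U a₀ a' * ∑ b', U a₀ b' * ∑ c', star (U a₀ c') * ∑ d', star (U a₀ d') *
        W a' b' c' d' = W a₀ a₀ a₀ a₀ := by
      rw [← hinv U hU a₀ a₀ a₀ a₀]
      simp only [Finset.mul_sum, mul_assoc]
    simp only [hsum, hsum'] at h
    have z1 := hsupp a₀ a₀ a₀ b₀ (by simp [h₀]) (by simp [h₀])
    have z2 := hsupp a₀ a₀ b₀ a₀ (by simp [h₀]) (by simp [h₀])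
    have z3 := hsupp a₀ a₀ b₀ b₀ (by simp [h₀]) (by simp [h₀])
    have z4 := hsupp a₀ b₀ a₀ a₀ (by simp [h₀.symm]) (by simp [h₀.symm])
    have z5 := hsupp a₀ b₀ b₀ b₀ (by simp [h₀]) (by simp [h₀])
    have z6 := hsupp b₀ a₀ a₀ a₀ (by simp [h₀.symm]) (by simp [h₀.symm])
    have z7 := hsupp b₀ a₀ b₀ b₀ (by simp [h₀]) (by simp [h₀])
    have z8 := hsupp b₀ b₀ a₀ a₀ (by simp [h₀.symm]) (by simp [h₀.symm])
    have z9 := hsupp b₀ b₀ a₀ b₀ (by simp [h₀.symm]) (by simp [h₀.symm])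
    have z10 := hsupp b₀ b₀ b₀ a₀ (by simp [h₀.symm]) (by simp [h₀.symm])
    have p := hperm (Equiv.swap a₀ b₀)
    have p1 := p a₀ a₀ a₀ a₀
    have p2 := p a₀ b₀ a₀ b₀
    have p3 := p a₀ b₀ b₀ a₀
    simp only [Equiv.swap_apply_left, Equiv.swap_apply_right] at p1 p2 p3
    rw [z1, z2, z3, z4, z5, z6, z7, z8, z9, z10, p1, p2, p3] at h
    -- The pattern aaaa has total weight (81 + 256)/625 and each of the other two patterns 288/625,
    -- while 625 - 337 = 288.
    linear_combination (-625 / 288 : ℂ) * h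
  refine ⟨fun s => if s then W a₀ b₀ b₀ a₀ else W a₀ b₀ a₀ b₀, ?_⟩
  funext x
  obtain ⟨x1, x2⟩ := x
  have e1 : x1 = ![x1 0, x1 1] := by ext i; fin_cases i <;> rfl
  have e2 : x2 = ![x2 0, x2 1] := by ext i; fin_cases i <;> rfl
  have e3 : w (x1, x2) = W (x1 0) (x1 1) (x2 0) (x2 1) := by
    simp only [hW]; rw [← e1, ← e2]
  rw [e3]
  have key : ∀ a b c d, W a b c d =
      (W a₀ b₀ b₀ a₀ * if a = d ∧ b = c then 1 else 0) +
        W a₀ b₀ a₀ b₀ * if a = c ∧ b = d then 1 else 0 := by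
    intro a b c d
    by_cases h1 : a = c ∧ b = d
    · obtain ⟨rfl, rfl⟩ := h1
      by_cases hab : a = b
      · subst hab
        have := hperm (Equiv.swap a₀ a) a₀ a₀ a₀ a₀
        simp only [Equiv.swap_apply_left] at this
        simp only [and_self, if_true]
        rw [this, hrot]; ring
      · obtain ⟨τ, t1, t2⟩ := htrans a₀ b₀ a b h₀ hab
        have := hperm τ a₀ b₀ a₀ b₀
        rw [t1, t2] at this
        rw [this]
        simp [hab]
    · by_cases h2 : a = d ∧ b = c
      · obtain ⟨rfl, rfl⟩ := h2
        have hab : a ≠ b := fun h => h1 ⟨h, h.symm⟩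
        obtain ⟨τ, t1, t2⟩ := htrans a₀ b₀ a b h₀ hab
        have := hperm τ a₀ b₀ b₀ a₀
        rw [t1, t2] at this
        rw [this]
        simp [hab]
      · rw [hsupp a b c d h1 h2, if_neg h1, if_neg h2]
        ring
  simp only [Finset.sum_apply, Pi.smul_apply, Fintype.sum_bool, permVec_true, permVec_false,
    smul_eq_mul, if_true, Bool.false_eq_true, if_false]
  exact key _ _ _ _

end Invariants

/-! ### The second Haar moment operator. -/

section HaarMoments

variable {D : Type*} [Fintype D] [DecidableEq D]

instance instIsProbabilityMeasureHaar : IsProbabilityMeasure (haar D) := by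
  refine ⟨?_⟩
  have := Measure.haarMeasure_self (G := Matrix.unitaryGroup D ℂ) (K₀ := ⊤)
  simpa [haar] using this

instance instIsMulLeftInvariantHaar : (haar D).IsMulLeftInvariant := by
  unfold haar
  infer_instance

instance instSecondCountableTopologyUnitary :
    SecondCountableTopology (Matrix.unitaryGroup D ℂ) := by
  have : SecondCountableTopology (Matrix D D ℂ) :=
    inferInstanceAs (SecondCountableTopology (D → D → ℂ))
  exact TopologicalSpace.Subtype.secondCountableTopology _

theorem continuous_tensorPowConj (k : ℕ) (x y : (Fin k → D) × (Fin k → D)) :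
    Continuous fun U : Matrix.unitaryGroup D ℂ => tensorPowConj k U.1 x y := by
  have h : ∀ a b, Continuous fun U : Matrix.unitaryGroup D ℂ => U.1 a b := fun a b =>
    continuous_subtype_val.matrix_elem a b
  simp only [tensorPowConj, tensorPow, Matrix.kronecker, Matrix.kroneckerMap_apply,
    Matrix.of_apply, Matrix.map_apply]
  exact (continuous_finsetProd _ fun _ _ => h _ _).mul
    (continuous_finsetProd _ fun _ _ => (h _ _).star)

theorem integrable_tensorPowConj (k : ℕ) (ν : Measure (Matrix.unitaryGroup D ℂ))
    [IsFiniteMeasure ν] (x y : (Fin k → D) × (Fin k → D)) :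
    Integrable (fun U : Matrix.unitaryGroup D ℂ => tensorPowConj k U.1 x y) ν :=
  (continuous_tensorPowConj k x y).integrable_of_hasCompactSupport
    (HasCompactSupport.of_compactSpace _)

theorem mul_momentOperator_apply (k : ℕ) (ν : Measure (Matrix.unitaryGroup D ℂ))
    [IsFiniteMeasure ν] (A : Matrix ((Fin k → D) × (Fin k → D)) ((Fin k → D) × (Fin k → D)) ℂ)
    (x y) : (A * momentOperator k ν) x y = ∫ U, (A * tensorPowConj k U.1) x y ∂ν := by
  simp only [Matrix.mul_apply, momentOperator, Matrix.of_apply]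
  rw [integral_finsetSum _ fun z _ => (integrable_tensorPowConj k ν z y).const_mul _]
  exact Finset.sum_congr rfl fun z _ => (integral_const_mul _ _).symm

theorem momentOperator_mul_apply (k : ℕ) (ν : Measure (Matrix.unitaryGroup D ℂ))
    [IsFiniteMeasure ν] (A : Matrix ((Fin k → D) × (Fin k → D)) ((Fin k → D) × (Fin k → D)) ℂ)
    (x y) : (momentOperator k ν * A) x y = ∫ U, (tensorPowConj k U.1 * A) x y ∂ν := by
  simp only [Matrix.mul_apply, momentOperator, Matrix.of_apply]
  rw [integral_finsetSum _ fun z _ => (integrable_tensorPowConj k ν x z).mul_const _]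
  exact Finset.sum_congr rfl fun z _ => (integral_mul_const _ _).symm

theorem tensorPowConj_mul_momentOperator_haar (k : ℕ) (V : Matrix.unitaryGroup D ℂ) :
    tensorPowConj k V.1 * momentOperator k (haar D) = momentOperator k (haar D) := by
  ext x y
  rw [mul_momentOperator_apply]
  simp only [← tensorPowConj_mul]
  exact integral_mul_left_eq_self
    (fun U : Matrix.unitaryGroup D ℂ => tensorPowConj k U.1 x y) V

/-- The second moment operator of the Haar measure is the projection onto the span of the two
permutation vectors. -/
theorem momentOperator_haar (hD : 1 < Fintype.card D) :
    momentOperator 2 (haar D) = permProj D := by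
  -- Averaging over U, since the projection absorbs every U. Conversely, in `h2`, left invariance
  -- makes each column of the moment operator an invariant vector, hence fixed by the projection.
  have h1 : permProj D * momentOperator 2 (haar D) = permProj D := by
    ext x y
    rw [mul_momentOperator_apply]
    simp only [permProj_mul_tensorPowConj hD (Subtype.property _)]
    simp
  have h2 : permProj D * momentOperator 2 (haar D) = momentOperator 2 (haar D) := by
    refine Matrix.ext_of_mulVec_single fun i => ?_
    rw [← Matrix.mulVec_mulVec]
    obtain ⟨c, hc⟩ := exists_eq_sum_permVec hD (momentOperator 2 (haar D) *ᵥ Pi.single i 1)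
      fun U hU => by
        rw [Matrix.mulVec_mulVec, tensorPowConj_mul_momentOperator_haar 2 ⟨U, hU⟩]
    rw [hc, Matrix.mulVec_sum]
    simp only [Matrix.mulVec_smul, permProj_mulVec_permVec hD]
  rw [← h2, h1]

end HaarMoments

/-! ### Moment operators of random circuits. -/

section Circuits

variable {D : Type*} [Fintype D] [DecidableEq D]

theorem momentOperator_dirac_one (k : ℕ) :
    momentOperator k (Measure.dirac (1 : Matrix.unitaryGroup D ℂ)) = 1 := by
  ext x y
  simp only [momentOperator, Matrix.of_apply]
  rw [integral_dirac]
  exact congrFun (congrFun (tensorPowConj_one k) x) y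

/-- U ↦ U^{⊗ k,k} is multiplicative, so independence of the factors makes the average
multiplicative. -/
theorem momentOperator_mconv (k : ℕ) (μ ν : Measure (Matrix.unitaryGroup D ℂ))
    [IsProbabilityMeasure μ] [IsProbabilityMeasure ν] :
    momentOperator k (μ.mconv ν) = momentOperator k μ * momentOperator k ν := by
  ext x y
  rw [momentOperator_mul_apply]
  simp only [mul_momentOperator_apply]
  simp only [momentOperator, Matrix.of_apply]
  rw [integral_mconv (integrable_tensorPowConj k _ x y)]
  simp only [Submonoid.coe_mul, tensorPowConj_mul]

variable {q n : ℕ}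

theorem continuous_gate {i j : Fin n} (hij : i ≠ j) :
    Continuous (gate (q := q) hij) := by
  refine Continuous.subtype_mk (continuous_matrix fun x y => ?_) _
  simp only [embedMatrix, Matrix.of_apply]
  split_ifs
  · exact continuous_subtype_val.matrix_elem _ _
  · exact continuous_const

theorem isProbabilityMeasure_stepMeasure (G : SimpleGraph (Fin n)) [Nonempty (Edge G)] :
    IsProbabilityMeasure (stepMeasure q G) := by
  refine ⟨?_⟩
  have h : ∀ e : Edge G, ((haar (Fin q × Fin q)).map (gate e.2.1.ne)) Set.univ = 1 := by
    intro e
    have := Measure.isProbabilityMeasure_map (μ := haar (Fin q × Fin q))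
      (continuous_gate e.2.1.ne).measurable.aemeasurable
    exact measure_univ
  simp only [stepMeasure, Measure.smul_apply, Measure.finsetSum_apply, h, smul_eq_mul]
  simp only [Finset.sum_const, Finset.card_univ, nsmul_eq_mul, mul_one]
  exact ENNReal.inv_mul_cancel (by simp) (by simp)

theorem isProbabilityMeasure_circuitMeasure (G : SimpleGraph (Fin n)) [Nonempty (Edge G)] (t : ℕ) :
    IsProbabilityMeasure (circuitMeasure q G t) := by
  have := isProbabilityMeasure_stepMeasure (q := q) G
  induction t with
  | zero => unfold circuitMeasure; infer_instance
  | succ t ih => unfold circuitMeasure; infer_instance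

theorem momentOperator_circuitMeasure (k : ℕ) (G : SimpleGraph (Fin n)) [Nonempty (Edge G)]
    (t : ℕ) : momentOperator k (circuitMeasure q G t) = momentOperator k (stepMeasure q G) ^ t := by
  have := isProbabilityMeasure_stepMeasure (q := q) G
  induction t with
  | zero => rw [circuitMeasure, momentOperator_dirac_one, pow_zero]
  | succ t ih =>
    have := isProbabilityMeasure_circuitMeasure (q := q) G t
    rw [circuitMeasure, momentOperator_mconv, ih, pow_succ']

theorem momentOperator_stepMeasure (k : ℕ) (G : SimpleGraph (Fin n)) [Nonempty (Edge G)] :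
    momentOperator k (stepMeasure q G) =
      (Fintype.card (Edge G) : ℂ)⁻¹ • ∑ e : Edge G, localMoment q k e := by
  ext x y
  simp only [momentOperator, stepMeasure, Matrix.of_apply, Matrix.smul_apply, Matrix.sum_apply,
    localMoment]
  have hfin : ∀ e : Edge G, IsProbabilityMeasure ((haar (Fin q × Fin q)).map (gate e.2.1.ne)) :=
    fun e => Measure.isProbabilityMeasure_map (continuous_gate e.2.1.ne).measurable.aemeasurable
  rw [integral_smul_measure, integral_finsetSum_measure fun e _ => integrable_tensorPowConj k _ x y]
  have h : ∀ e : Edge G, ∫ U, tensorPowConj k U.1 x y ∂((haar (Fin q × Fin q)).map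
      (gate (n := n) e.2.1.ne)) =
      ∫ U, tensorPowConj k (gate (n := n) e.2.1.ne U).1 x y ∂(haar (Fin q × Fin q)) := fun e =>
    integral_map (continuous_gate e.2.1.ne).measurable.aemeasurable
      (continuous_tensorPowConj k x y).aestronglyMeasurable
  simp only [h]
  rw [ENNReal.toReal_inv, ENNReal.toReal_natCast, Complex.real_smul, smul_eq_mul]
  push_cast
  rfl

theorem momentOperator_stepMeasure_eq_sub (k : ℕ) (G : SimpleGraph (Fin n)) [Nonempty (Edge G)] :
    momentOperator k (stepMeasure q G) =
      1 - (Fintype.card (Edge G) : ℂ)⁻¹ • hamiltonian q k G := by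
  have hc : (Fintype.card (Edge G) : ℂ) ≠ 0 := by
    exact_mod_cast Fintype.card_ne_zero
  rw [momentOperator_stepMeasure, hamiltonian, Finset.sum_sub_distrib, Finset.sum_const,
    Finset.card_univ, smul_sub, ← Nat.cast_smul_eq_nsmul ℂ, smul_smul, inv_mul_cancel₀ hc, one_smul]
  abel

end Circuits

/-! ### The local moment operator as a pair projection. -/

section LocalMoments

variable {q n : ℕ}

/-- The part of a moment index on the sites `i, j`. -/
def pairIdx (i j : Fin n) (x : MomentIdx (Config q n)) : MomentIdx (Fin q × Fin q) :=
  (fun a => (x.1 a i, x.1 a j), fun a => (x.2 a i, x.2 a j))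

theorem permVec_pairIdx (s : Bool) (i j : Fin n) (x : MomentIdx (Config q n)) :
    permVec (Fin q × Fin q) s (pairIdx i j x) =
      permVec (Fin q) s (locEquiv _ _ x i) * permVec (Fin q) s (locEquiv _ _ x j) := by
  simp only [permVec, ← ite_and, mul_ite, mul_one, mul_zero]
  refine if_congr ?_ rfl rfl
  simp only [pairIdx, locEquiv, funext_iff, Equiv.coe_fn_mk, Function.comp, Prod.mk.injEq,
    forall_and]
  exact and_comm

theorem tensorPowConj_embedMatrix (i j : Fin n) (A : Matrix (Fin q × Fin q) (Fin q × Fin q) ℂ)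
    (x y : MomentIdx (Config q n)) :
    tensorPowConj 2 (embedMatrix i j A) x y =
      if ∀ l, l ≠ i → l ≠ j → locEquiv _ _ x l = locEquiv _ _ y l then
        tensorPowConj 2 A (pairIdx i j x) (pairIdx i j y) else 0 := by
  have h : (∀ l, l ≠ i → l ≠ j → locEquiv (Fin n) (Fin q) x l = locEquiv _ _ y l) ↔
      (∀ a l, l ≠ i → l ≠ j → x.1 a l = y.1 a l) ∧ ∀ a l, l ≠ i → l ≠ j → x.2 a l = y.2 a l := by
    simp only [locEquiv, Equiv.coe_fn_mk, Prod.mk.injEq, funext_iff]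
    exact ⟨fun h => ⟨fun a l hi hj => (h l hi hj).1 a, fun a l hi hj => (h l hi hj).2 a⟩,
      fun h l hi hj => ⟨fun a => h.1 a l hi hj, fun a => h.2 a l hi hj⟩⟩
  simp only [h, tensorPowConj, tensorPow, Matrix.kronecker, Matrix.kroneckerMap_apply,
    Matrix.of_apply, Matrix.map_apply, embedMatrix, apply_ite star, star_zero,
    Fintype.prod_ite_zero]
  by_cases h1 : ∀ a l, l ≠ i → l ≠ j → x.1 a l = y.1 a l
  · by_cases h2 : ∀ a l, l ≠ i → l ≠ j → x.2 a l = y.2 a l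
    · rw [if_pos h1, if_pos h2, if_pos ⟨h1, h2⟩]
      rfl
    · rw [if_neg h2, mul_zero, if_neg fun h3 => h2 h3.2]
  · rw [if_neg h1, zero_mul, if_neg fun h3 => h1 h3.1]

/-- Entrywise, the embedded gate is the two-qudit gate times a delta on the other sites. The
integral is therefore the Haar moment for dimension q², whose permutation vectors factor over the
two sites. -/
theorem localMoment_eq (hq : 2 ≤ q) {G : SimpleGraph (Fin n)} (e : Edge G) :
    localMoment q 2 e = pairProj (q : ℝ) (siteOp (F := Fin q) e.1.1) (siteOp e.1.2) := by
  have hcard : 1 < Fintype.card (Fin q × Fin q) := by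
    simp only [Fintype.card_prod, Fintype.card_fin]; nlinarith
  have hM := momentOperator_haar hcard
  ext x y
  simp only [localMoment, Matrix.of_apply, gate, tensorPowConj_embedMatrix]
  have hR : pairProj (q : ℝ) (siteOp (F := Fin q) e.1.1) (siteOp e.1.2) x y =
      if ∀ l, l ≠ e.1.1 → l ≠ e.1.2 → locEquiv (Fin n) (Fin q) x l = locEquiv _ _ y l then
        permProj (Fin q × Fin q) (pairIdx e.1.1 e.1.2 x) (pairIdx e.1.1 e.1.2 y) else 0 := by
    simp only [pairProj, permProj, spanProj, Matrix.sum_apply, Matrix.smul_apply,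
      siteOp_mul_apply e.2.1.ne, permMat, Matrix.vecMulVec_apply, permVec_pairIdx,
      Fintype.card_prod, Fintype.card_fin, ← sq, Nat.cast_pow]
    split_ifs
    · rfl
    · simp
  rw [hR, ← hM]
  split_ifs
  · rfl
  · simp

end LocalMoments

/-! ### Pair projections acting on product operators. -/

section ProductOperators

variable {ι F : Type*} [Fintype ι] [DecidableEq ι] [Fintype F] [DecidableEq F]

theorem siteOp_mul_piOp {i : ι} {s t t' : Bool} {B : ι → Matrix (MomentIdx F) (MomentIdx F) ℂ}
    (h : B i = permMat F s t') :
    siteOp i s t * piOp B = gram (Fintype.card F) t s • piOp B := by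
  have h1 : (Pi.mulSingle i (permMat F s t) : ι → _) * B =
      Pi.mulSingle i (gram (Fintype.card F) t s • (1 : Matrix (MomentIdx F) (MomentIdx F) ℂ)) * B := by
    funext l
    by_cases hl : l = i
    · subst hl
      rw [Pi.mul_apply, Pi.mul_apply, Pi.mulSingle_eq_same, Pi.mulSingle_eq_same, h,
        isSite_permMat.mul, Matrix.smul_mul, one_mul]
    · rw [Pi.mul_apply, Pi.mul_apply, Pi.mulSingle_eq_of_ne hl, Pi.mulSingle_eq_of_ne hl]
  rw [siteOp, ← map_mul, h1, map_mul, piOp_mulSingle_smul, Pi.mulSingle_one, map_one,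
    Matrix.smul_mul, one_mul]

/-- The projection fixes |σ_sσ_s⟩⟨σ_sσ_s| on the two sites; applied to `piOp B` that operator is a
nonzero multiple of the identity, and the factor cancels. -/
theorem pairProj_mul_piOp (hF : 1 < Fintype.card F) {i j : ι} (hij : i ≠ j) {s t : Bool}
    {B : ι → Matrix (MomentIdx F) (MomentIdx F) ℂ} (hi : B i = permMat F s t)
    (hj : B j = permMat F s t) :
    pairProj (Fintype.card F : ℝ) (siteOp (F := F) i) (siteOp j) * piOp B = piOp B := by
  have hd : (1 : ℝ) < Fintype.card F := by exact_mod_cast hF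
  have hg : gram (Fintype.card F) s s ≠ 0 := by
    simp only [gram, if_true]
    exact pow_ne_zero _ (by exact_mod_cast (by omega))
  have h1 : (siteOp i s s * siteOp j s s) * piOp B =
      (gram (Fintype.card F) s s * gram (Fintype.card F) s s) • piOp B := by
    rw [mul_assoc, siteOp_mul_piOp hj, Matrix.mul_smul, siteOp_mul_piOp hi, smul_smul]
  have h2 := ((isSite_siteOp (F := F) i).pair (isSite_siteOp j) (siteOp_commute hij)).spanProj_mul
    (one_lt_mul_of_lt_of_le hd hd.le) s s
  have h3 := congrArg (· * piOp B) h2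
  simp only [mul_assoc (spanProj _ _)] at h3
  rw [h1, Matrix.mul_smul] at h3
  have h4 := smul_right_injective _ (mul_ne_zero hg hg) h3
  rw [pairProj, sq]
  exact h4

theorem pairProj_mul_piOp_eq_zero {q : ℝ} {i j : ι}
    {B : ι → Matrix (MomentIdx F) (MomentIdx F) ℂ} {l : ι} (hl : l = i ∨ l = j) (hij : i ≠ j)
    (h : ∀ s t, permMat F s t * B l = 0) :
    pairProj q (siteOp (F := F) i) (siteOp j) * piOp B = 0 := by
  simp only [pairProj, spanProj, Finset.sum_mul, Matrix.smul_mul]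
  refine Finset.sum_eq_zero fun s _ => Finset.sum_eq_zero fun t _ => ?_
  have : (siteOp i s t * siteOp j s t) * piOp B = 0 := by
    rw [siteOp, siteOp, ← map_mul, ← map_mul]
    refine piOp_eq_zero (l := l) ?_
    rcases hl with rfl | rfl
    · simp [hij, h]
    · simp [hij.symm, h]
  rw [this, smul_zero]

theorem permMat_pi (s t : Bool) :
    permMat (ι → F) s t = piOp fun _ => permMat F s t := by
  ext x y
  rw [piOp_apply]
  simp only [permMat, Matrix.vecMulVec_apply, permVec_pi, Finset.prod_mul_distrib]

end ProductOperators

/-! ### Counting edges of the complete graph. -/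

section EdgeSums

theorem sum_edge_eq {M : Type*} [AddCommMonoid M] {n : ℕ} (f : Fin n → Fin n → M) :
    ∑ e : Edge (⊤ : SimpleGraph (Fin n)), f e.1.1 e.1.2 =
      ∑ i, ∑ j, if i < j then f i j else 0 := by
  rw [← Fintype.sum_prod_type' (f := fun i j => if i < j then f i j else 0), ← Finset.sum_filter]
  symm
  refine (Finset.sum_subtype _ (fun x => ?_) (fun x : Fin n × Fin n => f x.1 x.2))
  simp only [Finset.mem_filter, Finset.mem_univ, true_and, SimpleGraph.top_adj]
  exact ⟨fun h => ⟨h, h.ne⟩, fun h => h.1⟩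

theorem sum_sum_eq_two_nsmul_sum_edge {M : Type*} [AddCommMonoid M] {n : ℕ} (f : Fin n → Fin n → M)
    (hf : ∀ i j, i ≠ j → f i j = f j i) :
    ∑ i, ∑ j, (if i = j then 0 else f i j) =
      2 • ∑ e : Edge (⊤ : SimpleGraph (Fin n)), f e.1.1 e.1.2 := by
  have h : ∀ i j, (if i = j then 0 else f i j) =
      (if i < j then f i j else 0) + if j < i then f j i else 0 := by
    intro i j
    rcases lt_trichotomy i j with h | h | h
    · rw [if_neg h.ne, if_pos h, if_neg h.asymm, add_zero]
    · rw [if_pos h, if_neg h.not_lt, if_neg h.not_gt, add_zero]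
    · rw [if_neg h.ne', if_neg h.asymm, if_pos h, zero_add, hf i j h.ne']
  simp only [h, Finset.sum_add_distrib]
  rw [sum_edge_eq, two_nsmul]
  congr 1
  exact Finset.sum_comm

theorem two_mul_card_edge (n : ℕ) :
    2 * (Fintype.card (Edge (⊤ : SimpleGraph (Fin n))) : ℝ) = n * (n - 1) := by
  have h := sum_sum_eq_two_nsmul_sum_edge (n := n) (fun _ _ => (1 : ℝ)) fun _ _ _ => rfl
  simp only [Finset.sum_const, Finset.card_univ, nsmul_eq_mul, mul_one] at h
  push_cast at h
  have h1 : ∀ i : Fin n, ∑ j, (if i = j then (0 : ℝ) else 1) = n - 1 := by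
    intro i
    have : ∀ j, (if i = j then (0 : ℝ) else 1) = 1 - if i = j then 1 else 0 := by
      intro j; split_ifs <;> simp
    simp [this, Finset.sum_sub_distrib]
  rw [← h]
  simp only [h1, Finset.sum_const, Finset.card_univ, Fintype.card_fin, nsmul_eq_mul]

theorem sum_edge_incident {n : ℕ} (i₀ : Fin n) :
    ∑ e : Edge (⊤ : SimpleGraph (Fin n)),
      (if i₀ = e.1.1 ∨ i₀ = e.1.2 then (1 : ℝ) else 0) = n - 1 := by
  have h := sum_sum_eq_two_nsmul_sum_edge (n := n)
    (fun i j => if i₀ = i ∨ i₀ = j then (1 : ℝ) else 0) fun i j _ => by simp only [or_comm]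
  -- Inclusion–exclusion; the correction at `i = j = i₀` is 2 rather than 1 because the diagonal
  -- must contribute 0.
  have h1 : ∀ i j : Fin n, (if i = j then (0 : ℝ) else if i₀ = i ∨ i₀ = j then 1 else 0) =
      (if i₀ = i then 1 else 0) + (if i₀ = j then 1 else 0) -
        if i₀ = i then (if i₀ = j then 2 else 0) else 0 := by
    intro i j
    by_cases hi : i₀ = i <;> by_cases hj : i₀ = j <;> by_cases hij : i = j <;> simp_all
    norm_num
  simp only [h1, Finset.sum_sub_distrib, Finset.sum_add_distrib] at h
  simp only [Finset.sum_ite_eq, Finset.mem_univ, if_true, Finset.sum_const, Finset.card_univ,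
    Fintype.card_fin, nsmul_eq_mul, mul_one, mul_ite, mul_zero, Finset.sum_ite_irrel] at h
  push_cast at h
  linarith

end EdgeSums

/-! ### Spectrum of the Hamiltonian and bounds on the gap. -/

section Spectra

theorem mem_spectrum_real_iff {N : Type*} [Fintype N] [DecidableEq N] {A : Matrix N N ℂ} {r : ℝ} :
    r ∈ spectrum ℝ A ↔ ∃ v : N → ℂ, v ≠ 0 ∧ A *ᵥ v = (r : ℂ) • v := by
  rw [← spectrum.algebraMap_mem_iff ℂ (r := r) (a := A), ← Matrix.spectrum_toLin',
    ← Module.End.hasEigenvalue_iff_mem_spectrum]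
  constructor
  · intro h
    obtain ⟨v, hv⟩ := h.exists_hasEigenvector
    exact ⟨v, hv.2, by simpa using hv.apply_eq_smul⟩
  · rintro ⟨v, hv, h⟩
    exact Module.End.hasEigenvalue_of_hasEigenvector
      (Module.End.hasEigenvector_iff.2 ⟨Module.End.mem_eigenspace_iff.2 (by simpa using h), hv⟩)

variable {q n : ℕ}

/-- The single-site operators as continuous linear maps. -/
def siteCLM (q : ℕ) {n : ℕ} (i : Fin n) (s t : Bool) :
    EuclideanSpace ℂ (MomentIdx (Config q n)) →L[ℂ] EuclideanSpace ℂ (MomentIdx (Config q n)) :=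
  Matrix.toEuclideanCLM (𝕜 := ℂ) (siteOp (F := Fin q) i s t)

theorem isSite_siteCLM (i : Fin n) : IsSite (q : ℝ) (siteCLM q i) := by
  have h := isSite_siteOp (F := Fin q) i
  rw [Fintype.card_fin] at h
  refine ⟨fun s t s' t' => ?_, fun s t => ?_⟩
  · simp only [siteCLM]
    rw [← map_mul, h.mul, map_smul]
  · simp only [siteCLM]
    rw [← map_star, h.star]

theorem siteCLM_commute {i j : Fin n} (hij : i ≠ j) (s t s' t' : Bool) :
    Commute (siteCLM q i s t) (siteCLM q j s' t') :=
  (siteOp_commute hij s t s' t').map (Matrix.toEuclideanCLM (𝕜 := ℂ))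

theorem toEuclideanCLM_localMoment (hq : 2 ≤ q) (e : Edge (⊤ : SimpleGraph (Fin n))) :
    Matrix.toEuclideanCLM (𝕜 := ℂ) (localMoment q 2 e) =
      pairProj (q : ℝ) (siteCLM q e.1.1) (siteCLM q e.1.2) := by
  rw [localMoment_eq hq]
  simp only [pairProj, spanProj, map_sum, map_smul, map_mul, siteCLM]

theorem isStarProjection_localMoment (hq : 2 ≤ q) (e : Edge (⊤ : SimpleGraph (Fin n))) :
    IsStarProjection (Matrix.toEuclideanCLM (𝕜 := ℂ) (localMoment q 2 e)) := by
  rw [toEuclideanCLM_localMoment hq]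
  exact isStarProjection_pairProj (by exact_mod_cast hq) (isSite_siteCLM _) (isSite_siteCLM _)
    (siteCLM_commute e.2.1.ne)

theorem toEuclideanCLM_hamiltonian_apply (x : EuclideanSpace ℂ (MomentIdx (Config q n))) :
    Matrix.toEuclideanCLM (𝕜 := ℂ) (hamiltonian q 2 (⊤ : SimpleGraph (Fin n))) x =
      ∑ e : Edge (⊤ : SimpleGraph (Fin n)),
        (1 - Matrix.toEuclideanCLM (𝕜 := ℂ) (localMoment q 2 e)) x := by
  simp only [hamiltonian, map_sum, map_sub, map_one, sum_apply]

theorem re_inner_hamiltonian (hq : 2 ≤ q) (x : EuclideanSpace ℂ (MomentIdx (Config q n))) :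
    (inner ℂ x (Matrix.toEuclideanCLM (𝕜 := ℂ)
      (hamiltonian q 2 (⊤ : SimpleGraph (Fin n))) x)).re =
      ∑ e : Edge (⊤ : SimpleGraph (Fin n)),
        ‖(1 - Matrix.toEuclideanCLM (𝕜 := ℂ) (localMoment q 2 e)) x‖ ^ 2 := by
  rw [toEuclideanCLM_hamiltonian_apply, inner_sum, Complex.re_sum]
  exact Finset.sum_congr rfl fun e _ =>
    re_inner_proj_self (isStarProjection_localMoment hq e).one_sub x

/-- The lower bound for the gap that comes out of the local estimates. -/
def gapBound (q n : ℕ) : ℝ := 1 + (1 - 2 * (q : ℝ) / ((q : ℝ) ^ 2 + 1)) * ((n : ℝ) - 2)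

/-- This is H² ≥ γH as quadratic forms. Passing from ordered pairs to edges puts a factor 4 on the
right and 2 · 2 on the left, which cancel. -/
theorem hamiltonian_gap (hq : 2 ≤ q) (x : EuclideanSpace ℂ (MomentIdx (Config q n))) :
    gapBound q n * (inner ℂ x (Matrix.toEuclideanCLM (𝕜 := ℂ)
      (hamiltonian q 2 (⊤ : SimpleGraph (Fin n))) x)).re ≤
      ‖Matrix.toEuclideanCLM (𝕜 := ℂ) (hamiltonian q 2 (⊤ : SimpleGraph (Fin n))) x‖ ^ 2 := by
  have h := sites_gap (q := q) (by exact_mod_cast hq) (e := fun i : Fin n => siteCLM q i)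
    isSite_siteCLM (fun i j hij => siteCLM_commute hij) x
  have hsymm : ∀ i j : Fin n, i ≠ j → pairProj (q : ℝ) (siteCLM q i) (siteCLM q j) =
      pairProj (q : ℝ) (siteCLM q j) (siteCLM q i) := fun i j hij =>
    pairProj_comm (siteCLM_commute hij)
  rw [sum_sum_eq_two_nsmul_sum_edge
    (fun i j => (1 - pairProj (q : ℝ) (siteCLM q i) (siteCLM q j)) x)
    fun i j hij => by rw [hsymm i j hij]] at h
  have h2 : ∑ i : Fin n, ∑ j, ‖if i = j then 0 else
      (1 - pairProj (q : ℝ) (siteCLM q i) (siteCLM q j)) x‖ ^ 2 =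
      2 • ∑ e : Edge (⊤ : SimpleGraph (Fin n)),
        ‖(1 - pairProj (q : ℝ) (siteCLM q e.1.1) (siteCLM q e.1.2)) x‖ ^ 2 := by
    rw [← sum_sum_eq_two_nsmul_sum_edge
      (fun i j => ‖(1 - pairProj (q : ℝ) (siteCLM q i) (siteCLM q j)) x‖ ^ 2)
      fun i j hij => by rw [hsymm i j hij]]
    refine Finset.sum_congr rfl fun i _ => Finset.sum_congr rfl fun j _ => ?_
    split_ifs <;> simp
  rw [h2] at h
  rw [re_inner_hamiltonian hq, toEuclideanCLM_hamiltonian_apply]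
  simp only [toEuclideanCLM_localMoment hq]
  rw [← Nat.cast_smul_eq_nsmul ℝ, ← Nat.cast_smul_eq_nsmul ℝ, norm_smul, mul_pow] at h
  simp only [Nat.cast_ofNat, Real.norm_ofNat, smul_eq_mul, Fintype.card_fin] at h
  rw [gapBound]
  linarith

/-- On an eigenvector, H ≥ 0 and H² ≥ γH read r ≥ 0 and γr ≤ r². -/
theorem eigenvalue_hamiltonian (hq : 2 ≤ q) {r : ℝ} {v : MomentIdx (Config q n) → ℂ}
    (hv : v ≠ 0) (h : hamiltonian q 2 (⊤ : SimpleGraph (Fin n)) *ᵥ v = (r : ℂ) • v) :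
    0 ≤ r ∧ (r = 0 ∨ gapBound q n ≤ r) := by
  set x : EuclideanSpace ℂ (MomentIdx (Config q n)) := WithLp.toLp 2 v with hx
  have hHx : Matrix.toEuclideanCLM (𝕜 := ℂ) (hamiltonian q 2 (⊤ : SimpleGraph (Fin n))) x =
      (r : ℂ) • x := by
    rw [hx, Matrix.toEuclideanCLM_toLp, h]
    rfl
  have hx0 : 0 < ‖x‖ := norm_pos_iff.2 fun h0 => hv (by simpa [hx] using h0)
  have h1 := hamiltonian_gap hq x
  have h2 := re_inner_hamiltonian hq x
  have h3 : (inner ℂ x ((r : ℂ) • x)).re = r * ‖x‖ ^ 2 := by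
    rw [inner_smul_right, inner_self_eq_norm_sq_to_K (𝕜 := ℂ), Complex.re_ofReal_mul]
    norm_cast
  rw [hHx, h3] at h1 h2
  rw [norm_smul, mul_pow, Complex.norm_real, Real.norm_eq_abs, sq_abs] at h1
  have hr : 0 ≤ r := by
    have : 0 ≤ r * ‖x‖ ^ 2 := by
      rw [h2]
      exact Finset.sum_nonneg fun e _ => sq_nonneg _
    exact nonneg_of_mul_nonneg_left this (pow_pos hx0 2)
  refine ⟨hr, ?_⟩
  rcases eq_or_lt_of_le hr with h0 | h0
  · exact Or.inl h0.symm
  · right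
    have : gapBound q n * (r * ‖x‖ ^ 2) ≤ r * (r * ‖x‖ ^ 2) := h1.trans_eq (by ring)
    exact le_of_mul_le_mul_right this (mul_pos h0 (pow_pos hx0 2))

theorem localMoment_mul_piOp (hq : 2 ≤ q) (e : Edge (⊤ : SimpleGraph (Fin n))) {s t : Bool}
    {B : Fin n → Matrix (MomentIdx (Fin q)) (MomentIdx (Fin q)) ℂ}
    (h1 : B e.1.1 = permMat (Fin q) s t) (h2 : B e.1.2 = permMat (Fin q) s t) :
    localMoment q 2 e * piOp B = piOp B := by
  rw [localMoment_eq hq]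
  have := pairProj_mul_piOp (F := Fin q) (by rw [Fintype.card_fin]; omega) e.2.1.ne h1 h2
  rwa [Fintype.card_fin] at this

/-- Any nonzero column of `B` is an eigenvector. Eigenvectors of product form can thus be supplied
as product operators. -/
theorem mem_spectrum_of_mul_eq {N : Type*} [Fintype N] [DecidableEq N] {A B : Matrix N N ℂ}
    {r : ℝ} (hB : B ≠ 0) (h : A * B = (r : ℂ) • B) : r ∈ spectrum ℝ A := by
  rw [mem_spectrum_real_iff]
  obtain ⟨i, j, hij⟩ : ∃ i j, B i j ≠ 0 := by
    by_contra! h0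
    exact hB (Matrix.ext h0)
  refine ⟨B *ᵥ Pi.single j 1, fun h0 => hij ?_, ?_⟩
  · simpa using congrFun h0 i
  · rw [Matrix.mulVec_mulVec, h, Matrix.smul_mulVec]

theorem zero_mem_spectrum_hamiltonian (hq : 2 ≤ q) :
    (0 : ℝ) ∈ spectrum ℝ (hamiltonian q 2 (⊤ : SimpleGraph (Fin n))) := by
  have : NeZero q := ⟨by omega⟩
  refine mem_spectrum_of_mul_eq (B := permMat (Config q n) false false) (fun h => ?_) ?_
  · have := congrFun (congrFun h (fun _ _ => 0, fun _ _ => 0)) (fun _ _ => 0, fun _ _ => 0)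
    simp [permMat, Matrix.vecMulVec_apply, permVec_false] at this
  · rw [permMat_pi, hamiltonian, Finset.sum_mul]
    have h : ∀ e : Edge (⊤ : SimpleGraph (Fin n)), localMoment q 2 e *
        piOp (fun _ => permMat (Fin q) false false) = piOp fun _ => permMat (Fin q) false false :=
      fun e => localMoment_mul_piOp hq e rfl rfl
    rw [Complex.ofReal_zero, zero_smul]
    exact Finset.sum_eq_zero fun e _ => by rw [sub_mul, h, one_mul, sub_self]

theorem sub_one_mem_spectrum_hamiltonian (hq : 2 ≤ q) (hn : 2 ≤ n) :
    ((n : ℝ) - 1) ∈ spectrum ℝ (hamiltonian q 2 (⊤ : SimpleGraph (Fin n))) := by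
  set a : Fin q := ⟨0, by omega⟩
  set b : Fin q := ⟨1, by omega⟩
  have hab : a ≠ b := by simp [a, b]
  set i₀ : Fin n := ⟨0, by omega⟩
  -- The label multisets {a, a} and {a, b} differ, so both permutation vectors vanish at `p` and the
  -- basis vector at `p` is orthogonal to them.
  set p : MomentIdx (Fin q) := (![a, a], ![a, b]) with hp
  have hpv : ∀ t, permVec (Fin q) t p = 0 := by
    intro t
    cases t <;> simp [permVec_true, permVec_false, hp, hab]
  set B : Fin n → Matrix (MomentIdx (Fin q)) (MomentIdx (Fin q)) ℂ := fun l =>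
    if l = i₀ then Matrix.vecMulVec (Pi.single p 1) (Pi.single p 1)
      else permMat (Fin q) false false with hB
  have hB0 : ∀ s t, permMat (Fin q) s t * B i₀ = 0 := by
    intro s t
    simp only [hB, if_true, permMat]
    rw [Matrix.vecMulVec_mul_vecMulVec, dotProduct_single, hpv]
    simp
  refine mem_spectrum_of_mul_eq (B := piOp B) (fun h => ?_) ?_
  · set x : MomentIdx (Config q n) :=
      (locEquiv (Fin n) (Fin q)).symm fun l => if l = i₀ then p else (![a, a], ![a, a])
    have h1 := congrFun (congrFun h x) x
    rw [piOp_apply, Matrix.zero_apply, Finset.prod_eq_zero_iff] at h1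
    obtain ⟨l, -, hl⟩ := h1
    revert hl
    simp only [x, Equiv.apply_symm_apply, hB]
    split_ifs
    · simp [Matrix.vecMulVec_apply]
    · simp [permMat, Matrix.vecMulVec_apply, permVec_false]
  · have hterm : ∀ e : Edge (⊤ : SimpleGraph (Fin n)), (1 - localMoment q 2 e) * piOp B =
        (((if i₀ = e.1.1 ∨ i₀ = e.1.2 then (1 : ℝ) else 0) : ℝ) : ℂ) • piOp B := by
      intro e
      split_ifs with he
      · have : localMoment q 2 e * piOp B = 0 := by
          rw [localMoment_eq hq]
          exact pairProj_mul_piOp_eq_zero he e.2.1.ne hB0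
        rw [sub_mul, this, one_mul, sub_zero]
        simp
      · push Not at he
        have := localMoment_mul_piOp hq e (B := B) (s := false) (t := false)
          (by simp [hB, he.1.symm]) (by simp [hB, he.2.symm])
        rw [sub_mul, this, one_mul, sub_self]
        simp
    rw [hamiltonian, Finset.sum_mul, Finset.sum_congr rfl fun e _ => hterm e, ← Finset.sum_smul,
      ← Complex.ofReal_sum, sum_edge_incident]

theorem completeGraphGap_bounds (hq : 2 ≤ q) (hn : 2 ≤ n) :
    gapBound q n ≤ completeGraphGap q n 2 ∧ completeGraphGap q n 2 ≤ (n : ℝ) - 1 := by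
  set S := spectrum ℝ (hamiltonian q 2 (⊤ : SimpleGraph (Fin n))) with hS
  have hmem : ∀ r ∈ S, 0 ≤ r ∧ (r = 0 ∨ gapBound q n ≤ r) := by
    intro r hr
    obtain ⟨v, hv, h⟩ := mem_spectrum_real_iff.1 hr
    exact eigenvalue_hamiltonian hq hv h
  have h0 : (0 : ℝ) ∈ S := zero_mem_spectrum_hamiltonian hq
  have hn1 : ((n : ℝ) - 1) ∈ S := sub_one_mem_spectrum_hamiltonian hq hn
  have hground : groundEnergy (hamiltonian q 2 (⊤ : SimpleGraph (Fin n))) = 0 :=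
    IsLeast.csInf_eq ⟨h0, fun r hr => (hmem r hr).1⟩
  have hnpos : (0 : ℝ) < (n : ℝ) - 1 := by
    have : (2 : ℝ) ≤ n := by exact_mod_cast hn
    linarith
  have hmem1 : ((n : ℝ) - 1) ∈ S \ {0} := ⟨hn1, hnpos.ne'⟩
  rw [completeGraphGap, spectralGap, hground, sub_zero]
  constructor
  -- The eigenvalue `n - 1` shows that the nonzero spectrum is nonempty, so the infimum is not the
  -- default value 0.
  · refine le_csInf ⟨_, hmem1⟩ fun r hr => ?_
    exact (hmem r hr.1).2.resolve_left hr.2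
  · exact csInf_le ⟨0, fun r hr => (hmem r hr.1).1⟩ hmem1

end Spectra

/-! ### Convergence of the circuit moments to the Haar moment. -/

section Mixing

variable {q n : ℕ}

theorem nonempty_edge_top (hn : 2 ≤ n) : Nonempty (Edge (⊤ : SimpleGraph (Fin n))) :=
  ⟨⟨(⟨0, by omega⟩, ⟨1, by omega⟩), by simp⟩⟩

theorem one_lt_card_config (hq : 2 ≤ q) (hn : 2 ≤ n) : 1 < Fintype.card (Config q n) := by
  simp only [Fintype.card_fun, Fintype.card_fin]
  exact Nat.one_lt_pow (by omega) (by omega)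

theorem localMoment_mul_permProj (hq : 2 ≤ q) (e : Edge (⊤ : SimpleGraph (Fin n))) :
    localMoment q 2 e * permProj (Config q n) = permProj (Config q n) := by
  have h : ∀ s t, localMoment q 2 e * permMat (Config q n) s t = permMat (Config q n) s t := by
    intro s t
    rw [permMat_pi]
    exact localMoment_mul_piOp hq e rfl rfl
  simp only [permProj, spanProj, Finset.mul_sum, Matrix.mul_smul, h]

theorem isSelfAdjoint_localMoment (hq : 2 ≤ q) (e : Edge (⊤ : SimpleGraph (Fin n))) :
    IsSelfAdjoint (localMoment q 2 e) := by
  have h := (isStarProjection_localMoment hq e).isSelfAdjoint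
  rw [isSelfAdjoint_iff, ← map_star] at h
  exact (Matrix.toEuclideanCLM (𝕜 := ℂ)).injective h

/-- The moment operator of one step of the complete-graph circuit. -/
def stepMoment (q n : ℕ) : Matrix (MomentIdx (Config q n)) (MomentIdx (Config q n)) ℂ :=
  momentOperator 2 (stepMeasure q (⊤ : SimpleGraph (Fin n)))

theorem stepMoment_eq (hn : 2 ≤ n) : stepMoment q n =
    (Fintype.card (Edge (⊤ : SimpleGraph (Fin n))) : ℂ)⁻¹ •
      ∑ e : Edge (⊤ : SimpleGraph (Fin n)), localMoment q 2 e := by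
  have := nonempty_edge_top hn
  exact momentOperator_stepMeasure 2 _

theorem isSelfAdjoint_stepMoment (hq : 2 ≤ q) (hn : 2 ≤ n) : IsSelfAdjoint (stepMoment q n) := by
  rw [stepMoment_eq hn, isSelfAdjoint_iff, star_smul, star_sum]
  congr 1
  · simp
  · exact Finset.sum_congr rfl fun e _ => (isSelfAdjoint_localMoment hq e).star_eq

theorem stepMoment_mul_permProj (hq : 2 ≤ q) (hn : 2 ≤ n) :
    stepMoment q n * permProj (Config q n) = permProj (Config q n) := by
  have := nonempty_edge_top hn
  have hc : (Fintype.card (Edge (⊤ : SimpleGraph (Fin n))) : ℂ) ≠ 0 := by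
    exact_mod_cast Fintype.card_ne_zero
  rw [stepMoment_eq hn, Matrix.smul_mul, Finset.sum_mul]
  simp only [localMoment_mul_permProj hq, Finset.sum_const, Finset.card_univ]
  rw [← Nat.cast_smul_eq_nsmul ℂ, smul_smul, inv_mul_cancel₀ hc, one_smul]

theorem permProj_mul_stepMoment (hq : 2 ≤ q) (hn : 2 ≤ n) :
    permProj (Config q n) * stepMoment q n = permProj (Config q n) := by
  have h := congrArg star (stepMoment_mul_permProj hq hn)
  rwa [star_mul, (isSelfAdjoint_stepMoment hq hn).star_eq,
    (isStarProjection_permProj (one_lt_card_config hq hn)).isSelfAdjoint.star_eq] at h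

/-- H is frustration-free: the energy is a sum of squared norms, so zero energy means that every
local projection fixes `v`. -/
theorem permProj_mulVec_of_hamiltonian (hq : 2 ≤ q) (hn : 2 ≤ n)
    {v : MomentIdx (Config q n) → ℂ}
    (h : hamiltonian q 2 (⊤ : SimpleGraph (Fin n)) *ᵥ v = 0) :
    permProj (Config q n) *ᵥ v = v := by
  have hedge : ∀ e : Edge (⊤ : SimpleGraph (Fin n)), localMoment q 2 e *ᵥ v = v := by
    have h1 := re_inner_hamiltonian hq (WithLp.toLp 2 v)
    rw [Matrix.toEuclideanCLM_toLp, h, WithLp.toLp_zero, inner_zero_right, Complex.zero_re,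
      eq_comm, Finset.sum_eq_zero_iff_of_nonneg fun e _ => sq_nonneg _] at h1
    intro e
    have h2 := h1 e (Finset.mem_univ e)
    rw [sq_eq_zero_iff, norm_eq_zero, ← map_one (Matrix.toEuclideanCLM (𝕜 := ℂ)), ← map_sub,
      Matrix.toEuclideanCLM_toLp, WithLp.toLp_eq_zero, Matrix.sub_mulVec, Matrix.one_mulVec,
      sub_eq_zero] at h2
    exact h2.symm
  have hpair : ∀ i j : Fin n, i < j →
      pairProj (q : ℝ) (siteOp (F := Fin q) i) (siteOp j) *ᵥ v = v := by
    intro i j hij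
    have := hedge ⟨(i, j), hij, hij.ne⟩
    rwa [localMoment_eq hq] at this
  refine permProj_mulVec_of_pairProj (by rw [Fintype.card_fin]; omega)
    (by rw [Fintype.card_fin]; omega) v fun i j hij => ?_
  rw [Fintype.card_fin]
  rcases lt_or_gt_of_ne hij with h1 | h1
  · exact hpair i j h1
  · rw [pairProj_comm (siteOp_commute hij)]
    exact hpair j i h1

/-- The contraction rate of one step of the complete-graph circuit. -/
def stepRate (q n : ℕ) : ℝ :=
  1 - gapBound q n / Fintype.card (Edge (⊤ : SimpleGraph (Fin n)))

theorem rate_const_le_one (q : ℕ) : 1 - 2 * (q : ℝ) / ((q : ℝ) ^ 2 + 1) ≤ 1 := by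
  have : 0 ≤ 2 * (q : ℝ) / ((q : ℝ) ^ 2 + 1) := by positivity
  linarith

theorem rate_const_pos (hq : 2 ≤ q) : 0 < 1 - 2 * (q : ℝ) / ((q : ℝ) ^ 2 + 1) := by
  have : (2 : ℝ) ≤ q := by exact_mod_cast hq
  rw [sub_pos, div_lt_one (by positivity)]
  nlinarith

theorem stepRate_nonneg (hn : 2 ≤ n) : 0 ≤ stepRate q n := by
  have := nonempty_edge_top hn
  have hc : (0 : ℝ) < Fintype.card (Edge (⊤ : SimpleGraph (Fin n))) := by
    exact_mod_cast Fintype.card_pos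
  have hn' : (2 : ℝ) ≤ n := by exact_mod_cast hn
  rw [stepRate, sub_nonneg, div_le_one hc, gapBound]
  have h1 := two_mul_card_edge n
  have h2 := rate_const_le_one q
  nlinarith [mul_le_mul_of_nonneg_right h2 (by linarith : 0 ≤ (n : ℝ) - 2)]

/-- For r ≠ 0 the eigenvector is killed by the global projection, so it is an eigenvector of the
step operator, an average of projections, whence r ≥ 0. It has H-eigenvalue |E|(1 - r), which cannot
be 0 since the kernel of H is fixed by the global projection; the gap then bounds r. -/
theorem eigenvalue_stepMoment_sub (hq : 2 ≤ q) (hn : 2 ≤ n) {r : ℝ}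
    {v : MomentIdx (Config q n) → ℂ} (hv : v ≠ 0)
    (h : (stepMoment q n - permProj (Config q n)) *ᵥ v = (r : ℂ) • v) :
    0 ≤ r ∧ r ≤ stepRate q n := by
  have := nonempty_edge_top hn
  have hc : (0 : ℝ) < Fintype.card (Edge (⊤ : SimpleGraph (Fin n))) := by
    exact_mod_cast Fintype.card_pos
  have hc' : (Fintype.card (Edge (⊤ : SimpleGraph (Fin n))) : ℂ) ≠ 0 := by
    exact_mod_cast hc.ne'
  rcases eq_or_ne r 0 with rfl | hr
  · exact ⟨le_rfl, stepRate_nonneg hn⟩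
  have hGv : permProj (Config q n) *ᵥ v = 0 := by
    have h1 := congrArg (permProj (Config q n) *ᵥ ·) h
    simp only [Matrix.mulVec_mulVec, mul_sub, permProj_mul_stepMoment hq hn,
      (isStarProjection_permProj (one_lt_card_config hq hn)).isIdempotentElem.eq, sub_self,
      Matrix.zero_mulVec, Matrix.mulVec_smul] at h1
    exact (smul_eq_zero.1 h1.symm).resolve_left (by exact_mod_cast hr)
  have hMv : stepMoment q n *ᵥ v = (r : ℂ) • v := by
    rwa [Matrix.sub_mulVec, hGv, sub_zero] at h
  constructor
  · set x : EuclideanSpace ℂ (MomentIdx (Config q n)) := WithLp.toLp 2 v with hx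
    have hx0 : 0 < ‖x‖ := norm_pos_iff.2 fun h0 => hv (by simpa [hx] using h0)
    have h1 : (inner ℂ x (Matrix.toEuclideanCLM (𝕜 := ℂ) (stepMoment q n) x)).re =
        r * ‖x‖ ^ 2 := by
      rw [hx, Matrix.toEuclideanCLM_toLp, hMv, WithLp.toLp_smul, inner_smul_right,
        inner_self_eq_norm_sq_to_K (𝕜 := ℂ), Complex.re_ofReal_mul]
      norm_cast
    have h2 : (inner ℂ x (Matrix.toEuclideanCLM (𝕜 := ℂ) (stepMoment q n) x)).re =
        (Fintype.card (Edge (⊤ : SimpleGraph (Fin n))) : ℝ)⁻¹ *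
          ∑ e : Edge (⊤ : SimpleGraph (Fin n)),
            ‖Matrix.toEuclideanCLM (𝕜 := ℂ) (localMoment q 2 e) x‖ ^ 2 := by
      have hcast : (Fintype.card (Edge (⊤ : SimpleGraph (Fin n))) : ℂ)⁻¹ =
          (((Fintype.card (Edge (⊤ : SimpleGraph (Fin n))) : ℝ)⁻¹ : ℝ) : ℂ) := by push_cast; rfl
      rw [stepMoment_eq hn, map_smul, map_sum, smul_apply, sum_apply, inner_smul_right, inner_sum,
        hcast, Complex.re_ofReal_mul, Complex.re_sum]
      congr 1
      exact Finset.sum_congr rfl fun e _ => re_inner_proj_self (isStarProjection_localMoment hq e) x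
    have h3 : 0 ≤ r * ‖x‖ ^ 2 := by
      rw [← h1, h2]
      exact mul_nonneg (inv_nonneg.2 hc.le) (Finset.sum_nonneg fun e _ => sq_nonneg _)
    exact nonneg_of_mul_nonneg_left h3 (pow_pos hx0 2)
  · have hM : stepMoment q n = 1 - (Fintype.card (Edge (⊤ : SimpleGraph (Fin n))) : ℂ)⁻¹ •
        hamiltonian q 2 (⊤ : SimpleGraph (Fin n)) := momentOperator_stepMeasure_eq_sub 2 _
    have hH : hamiltonian q 2 (⊤ : SimpleGraph (Fin n)) *ᵥ v =
        ((Fintype.card (Edge (⊤ : SimpleGraph (Fin n))) * (1 - r) : ℝ) : ℂ) • v := by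
      have h1 : hamiltonian q 2 (⊤ : SimpleGraph (Fin n)) =
          (Fintype.card (Edge (⊤ : SimpleGraph (Fin n))) : ℂ) • (1 - stepMoment q n) := by
        rw [hM, sub_sub_cancel, smul_smul, mul_inv_cancel₀ hc', one_smul]
      rw [h1, Matrix.smul_mulVec, Matrix.sub_mulVec, Matrix.one_mulVec, hMv]
      push_cast
      module
    rcases (eigenvalue_hamiltonian hq hv hH).2 with h0 | h0
    · exfalso
      rw [h0, Complex.ofReal_zero, zero_smul] at hH
      exact hv (by rw [← permProj_mulVec_of_hamiltonian hq hn hH, hGv])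
    · rw [stepRate, le_sub_comm, div_le_iff₀ hc]
      linarith

/-- The norm of a self-adjoint operator is its spectral radius. -/
theorem opNorm_le_of_eigenvalues {N : Type*} [Fintype N] [DecidableEq N] {A : Matrix N N ℂ}
    (hA : IsSelfAdjoint A) {ρ : ℝ} (hρ : 0 ≤ ρ)
    (h : ∀ (r : ℝ) (v : N → ℂ), v ≠ 0 → A *ᵥ v = (r : ℂ) • v → |r| ≤ ρ) : opNorm A ≤ ρ := by
  have hsa : IsSelfAdjoint (Matrix.toEuclideanCLM (𝕜 := ℂ) A) := hA.map _
  have h1 := hsa.spectralRadius_eq_nnnorm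
  have h2 : spectralRadius ℂ (Matrix.toEuclideanCLM (𝕜 := ℂ) A) ≤ (ρ.toNNReal : ℝ≥0∞) := by
    refine iSup₂_le fun k hk => ?_
    have hk' := hsa.mem_spectrum_eq_re hk
    have hs : spectrum ℂ (Matrix.toEuclideanCLM (𝕜 := ℂ) A) = spectrum ℂ A :=
      AlgEquiv.spectrum_eq (Matrix.toEuclideanCLM (𝕜 := ℂ) (n := N)) A
    rw [hs, hk'] at hk
    have hr : k.re ∈ spectrum ℝ A := (spectrum.algebraMap_mem_iff ℂ).1 hk
    obtain ⟨v, hv, hAv⟩ := mem_spectrum_real_iff.1 hr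
    have := h k.re v hv hAv
    rw [ENNReal.coe_le_coe, ← NNReal.coe_le_coe, Real.coe_toNNReal _ hρ, coe_nnnorm, hk',
      Complex.norm_real]
    exact this
  rw [h1, ENNReal.coe_le_coe, ← NNReal.coe_le_coe, Real.coe_toNNReal _ hρ] at h2
  exact h2

theorem opNorm_circuit_le (hq : 2 ≤ q) (hn : 2 ≤ n) (t : ℕ) :
    opNorm (momentOperator 2 (circuitMeasure q (⊤ : SimpleGraph (Fin n)) t) -
      momentOperator 2 (haar (Config q n))) ≤ stepRate q n ^ t := by
  have := nonempty_edge_top hn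
  have hG := isStarProjection_permProj (one_lt_card_config hq hn)
  rw [momentOperator_haar (one_lt_card_config hq hn), momentOperator_circuitMeasure]
  change opNorm (stepMoment q n ^ t - permProj (Config q n)) ≤ _
  have hnorm : opNorm (stepMoment q n - permProj (Config q n)) ≤ stepRate q n :=
    opNorm_le_of_eigenvalues ((isSelfAdjoint_stepMoment hq hn).sub hG.isSelfAdjoint)
      (stepRate_nonneg hn) fun r v hv h => by
        obtain ⟨h1, h2⟩ := eigenvalue_stepMoment_sub hq hn hv h
        rwa [abs_of_nonneg h1]
  -- The identity (M - G)^t = M^t - G fails at t = 0, where 1 - G is instead bounded as a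
  -- projection.
  rcases Nat.eq_zero_or_pos t with rfl | ht
  · rw [pow_zero, pow_zero, opNorm]
    refine ContinuousLinearMap.opNorm_le_bound _ zero_le_one fun x => ?_
    rw [one_mul]
    exact norm_proj_le (hG.one_sub.map (Matrix.toEuclideanCLM (𝕜 := ℂ))) x
  · have hpow : ∀ m : ℕ, (stepMoment q n - permProj (Config q n)) ^ (m + 1) =
        stepMoment q n ^ (m + 1) - permProj (Config q n) := by
      intro m
      induction m with
      | zero => rw [zero_add, pow_one, pow_one]
      | succ m ih =>
        have hpowG : ∀ k : ℕ, stepMoment q n ^ k * permProj (Config q n) =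
            permProj (Config q n) := by
          intro k
          induction k with
          | zero => rw [pow_zero, one_mul]
          | succ k ih => rw [pow_succ, mul_assoc, stepMoment_mul_permProj hq hn, ih]
        rw [pow_succ, ih, sub_mul, mul_sub, mul_sub, hpowG, permProj_mul_stepMoment hq hn,
          hG.isIdempotentElem.eq, sub_self, sub_zero, ← pow_succ]
    obtain ⟨m, rfl⟩ : ∃ m, t = m + 1 := ⟨t - 1, by omega⟩
    rw [← hpow, opNorm, map_pow]
    exact (norm_pow_le' _ (Nat.succ_pos m)).trans (pow_le_pow_left₀ (norm_nonneg _) hnorm _)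

theorem stepRate_pow_le (hq : 2 ≤ q) (hn : 2 ≤ n) {ε : ℝ} (hε : 0 < ε) {t : ℕ}
    (ht : (n : ℝ) / 2 * (1 - 2 * (q : ℝ) / ((q : ℝ) ^ 2 + 1))⁻¹ *
      (4 * (n : ℝ) * Real.log q + Real.log (1 / ε)) ≤ (t : ℝ)) :
    stepRate q n ^ t ≤ ε / (q : ℝ) ^ (4 * n) := by
  have := nonempty_edge_top hn
  have hc : (0 : ℝ) < Fintype.card (Edge (⊤ : SimpleGraph (Fin n))) := by
    exact_mod_cast Fintype.card_pos
  have hn' : (2 : ℝ) ≤ n := by exact_mod_cast hn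
  have hq0 : (0 : ℝ) < q := by exact_mod_cast (by omega : 0 < q)
  set c := 1 - 2 * (q : ℝ) / ((q : ℝ) ^ 2 + 1) with hcdef
  have hcpos : 0 < c := rate_const_pos hq
  have hc1 : c ≤ 1 := rate_const_le_one q
  set N : ℝ := (Fintype.card (Edge (⊤ : SimpleGraph (Fin n))) : ℝ) with hN
  have hN2 : 2 * N = n * (n - 1) := two_mul_card_edge n
  -- With N = n(n-1)/2 this reduces to 1 + c(n - 2) ≥ c(n - 1), that is, c ≤ 1. The summand 1 in
  -- `gapBound` is what makes the rate 2c/n available.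
  have hgap : 2 * c / n ≤ gapBound q n / N := by
    rw [div_le_div_iff₀ (by linarith) hc, gapBound, ← hcdef]
    nlinarith
  have h1 : stepRate q n ≤ Real.exp (-(2 * c / n)) := by
    have := Real.add_one_le_exp (-(2 * c / n))
    rw [stepRate]
    linarith
  calc stepRate q n ^ t ≤ Real.exp (-(2 * c / n)) ^ t := pow_le_pow_left₀ (stepRate_nonneg hn) h1 t
    _ = Real.exp (-(2 * c / n * t)) := by rw [← Real.exp_nat_mul]; congr 1; ring
    _ ≤ Real.exp (Real.log ε - (4 * n : ℕ) * Real.log q) := by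
      refine Real.exp_le_exp.2 ?_
      have h2 : 4 * (n : ℝ) * Real.log q + Real.log (1 / ε) ≤ 2 * c / n * t := by
        have h3 : 0 ≤ 2 * c / n := by positivity
        have h4 := mul_le_mul_of_nonneg_left ht h3
        have h5 : 2 * c / n * ((n : ℝ) / 2 * c⁻¹ *
            (4 * (n : ℝ) * Real.log q + Real.log (1 / ε))) =
            4 * (n : ℝ) * Real.log q + Real.log (1 / ε) := by
          field_simp
        rwa [h5] at h4
      rw [one_div, Real.log_inv] at h2
      push_cast
      linarith
    _ = ε / (q : ℝ) ^ (4 * n) := by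
      rw [Real.exp_sub, Real.exp_log hε, Real.exp_nat_mul, Real.exp_log hq0]

end Mixing

/-! ### Trace norm: singular vectors, duality and the rank bound. -/

section TraceNorm

variable {N : Type*} [Fintype N] [DecidableEq N]

/-- An orthonormal basis of right singular vectors. -/
def singularBasis (A : Matrix N N ℂ) : OrthonormalBasis N ℂ (EuclideanSpace ℂ N) :=
  (Matrix.isHermitian_conjTranspose_mul_self A).eigenvectorBasis

theorem inner_apply_singularBasis (A : Matrix N N ℂ) (i j : N) :
    inner ℂ (Matrix.toEuclideanCLM (𝕜 := ℂ) A (singularBasis A i))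
      (Matrix.toEuclideanCLM (𝕜 := ℂ) A (singularBasis A j)) =
      if i = j then (((Matrix.isHermitian_conjTranspose_mul_self A).eigenvalues j : ℝ) : ℂ)
        else 0 := by
  have h1 : Matrix.toEuclideanCLM (𝕜 := ℂ) (Aᴴ * A) (singularBasis A j) =
      (((Matrix.isHermitian_conjTranspose_mul_self A).eigenvalues j : ℝ) : ℂ) •
        singularBasis A j := by
    have h := (Matrix.isHermitian_conjTranspose_mul_self A).mulVec_eigenvectorBasis j
    apply (WithLp.ofLp_injective 2)
    rw [Matrix.ofLp_toEuclideanCLM]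
    exact h
  rw [← ContinuousLinearMap.adjoint_inner_right, ← ContinuousLinearMap.star_eq_adjoint, ← map_star,
    Matrix.star_eq_conjTranspose, ← mul_apply_eq_comp, ← map_mul, h1, inner_smul_right,
    orthonormal_iff_ite.1 (singularBasis A).orthonormal]
  simp

theorem norm_apply_singularBasis (A : Matrix N N ℂ) (i : N) :
    ‖Matrix.toEuclideanCLM (𝕜 := ℂ) A (singularBasis A i)‖ =
      √((Matrix.isHermitian_conjTranspose_mul_self A).eigenvalues i) := by
  have h := inner_apply_singularBasis A i i
  rw [if_pos rfl, inner_self_eq_norm_sq_to_K (𝕜 := ℂ)] at h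
  have h' : ‖Matrix.toEuclideanCLM (𝕜 := ℂ) A (singularBasis A i)‖ ^ 2 =
      (Matrix.isHermitian_conjTranspose_mul_self A).eigenvalues i := by
    apply Complex.ofReal_injective
    rw [← h, Complex.ofReal_pow]
    rfl
  rw [← h', Real.sqrt_sq (norm_nonneg _)]

theorem traceNorm_eq_sum (A : Matrix N N ℂ) :
    traceNorm A = ∑ i, ‖Matrix.toEuclideanCLM (𝕜 := ℂ) A (singularBasis A i)‖ :=
  Finset.sum_congr rfl fun i _ => (norm_apply_singularBasis A i).symm

/-- One half of trace-norm duality: expand each `w j` in the right singular basis of `Z`, then apply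
Cauchy–Schwarz for each singular vector. -/
theorem norm_sum_inner_le_traceNorm (Z : Matrix N N ℂ) {e : N → EuclideanSpace ℂ N}
    (he : ∀ z, ∑ j, ‖inner ℂ (e j) z‖ ^ 2 ≤ ‖z‖ ^ 2)
    (w : OrthonormalBasis N ℂ (EuclideanSpace ℂ N)) :
    ‖∑ j, inner ℂ (e j) (Matrix.toEuclideanCLM (𝕜 := ℂ) Z (w j))‖ ≤ traceNorm Z := by
  set b := singularBasis Z
  set T := Matrix.toEuclideanCLM (𝕜 := ℂ) Z
  have h1 : ∀ j, inner ℂ (e j) (T (w j)) = ∑ k, inner ℂ (b k) (w j) * inner ℂ (e j) (T (b k)) := by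
    intro j
    conv_lhs => rw [← b.sum_repr' (w j), map_sum, inner_sum]
    simp only [map_smul, inner_smul_right]
  simp only [h1]
  rw [Finset.sum_comm, traceNorm_eq_sum]
  refine (norm_sum_le _ _).trans (Finset.sum_le_sum fun k _ => ?_)
  have hcs := Finset.sum_mul_sq_le_sq_mul_sq Finset.univ (fun j => ‖inner ℂ (b k) (w j)‖)
    (fun j => ‖inner ℂ (e j) (T (b k))‖)
  have hb : ∑ j, ‖inner ℂ (b k) (w j)‖ ^ 2 = 1 := by
    have := w.sum_sq_norm_inner_right (b k)
    simp only [norm_inner_symm (b k)]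
    rw [this, b.orthonormal.1 k, one_pow]
  rw [hb, one_mul] at hcs
  have h2 := hcs.trans (he (T (b k)))
  have h3 := abs_le_of_sq_le_sq h2 (norm_nonneg _)
  calc ‖∑ j, inner ℂ (b k) (w j) * inner ℂ (e j) (T (b k))‖
      ≤ ∑ j, ‖inner ℂ (b k) (w j)‖ * ‖inner ℂ (e j) (T (b k))‖ := by
        refine (norm_sum_le _ _).trans_eq (Finset.sum_congr rfl fun j _ => norm_mul _ _)
    _ ≤ ‖T (b k)‖ := (le_abs_self _).trans h3

/-- The other half: normalize the images of the singular vectors. Zero singular values leave zero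
vectors, since the inverse of 0 is 0; hence a Bessel family rather than an orthonormal one. -/
theorem exists_dual_family (Y : Matrix N N ℂ) : ∃ e : N → EuclideanSpace ℂ N,
    (∀ z, ∑ j, ‖inner ℂ (e j) z‖ ^ 2 ≤ ‖z‖ ^ 2) ∧
    ∑ j, inner ℂ (e j) (Matrix.toEuclideanCLM (𝕜 := ℂ) Y (singularBasis Y j)) =
      (traceNorm Y : ℂ) := by
  classical
  set y : N → EuclideanSpace ℂ N := fun j =>
    Matrix.toEuclideanCLM (𝕜 := ℂ) Y (singularBasis Y j) with hy
  have horth : ∀ i j, i ≠ j → inner ℂ (y i) (y j) = 0 := fun i j hij => by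
    have := inner_apply_singularBasis Y i j
    rwa [if_neg hij] at this
  set e : N → EuclideanSpace ℂ N := fun j => ((‖y j‖⁻¹ : ℝ) : ℂ) • y j with he
  have hon : Orthonormal ℂ fun j : {j // y j ≠ 0} => e j := by
    refine ⟨fun j => ?_, fun i j hij => ?_⟩
    · simp only [he]
      rw [norm_smul, Complex.norm_real, norm_inv, norm_norm,
        inv_mul_cancel₀ (norm_ne_zero_iff.2 j.2)]
    · simp only [he]
      rw [inner_smul_left, inner_smul_right, horth _ _ fun h => hij (Subtype.ext h), mul_zero,
        mul_zero]
  refine ⟨e, fun z => ?_, ?_⟩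
  · have h1 := hon.sum_inner_products_le (s := Finset.univ) (x := z)
    refine le_trans (le_of_eq ?_) h1
    rw [← Finset.sum_subtype (Finset.univ.filter fun j => y j ≠ 0) (by simp)
      (fun j => ‖inner ℂ (e j) z‖ ^ 2), Finset.sum_filter]
    refine Finset.sum_congr rfl fun j _ => ?_
    split_ifs with h
    · rfl
    · have : y j = 0 := not_not.1 h
      simp [he, this]
  · rw [traceNorm_eq_sum]
    push_cast
    refine Finset.sum_congr rfl fun j _ => ?_
    change inner ℂ (e j) (y j) = ((‖y j‖ : ℝ) : ℂ)
    simp only [he]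
    rw [inner_smul_left, Complex.conj_ofReal, inner_self_eq_norm_sq_to_K (𝕜 := ℂ)]
    rcases eq_or_ne (‖y j‖) 0 with h | h
    · rw [h]; simp
    · have h' : ((‖y j‖ : ℝ) : ℂ) ≠ 0 := by exact_mod_cast h
      change ((‖y j‖⁻¹ : ℝ) : ℂ) * ((‖y j‖ : ℝ) : ℂ) ^ 2 = _
      push_cast
      field_simp

/-- The family dual to the sum is tested against each summand. -/
theorem traceNorm_sum_le {κ : Type*} (s : Finset κ) (Y : κ → Matrix N N ℂ) :
    traceNorm (∑ i ∈ s, Y i) ≤ ∑ i ∈ s, traceNorm (Y i) := by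
  obtain ⟨e, he, h⟩ := exists_dual_family (∑ i ∈ s, Y i)
  have h0 : 0 ≤ traceNorm (∑ i ∈ s, Y i) := Finset.sum_nonneg fun i _ => Real.sqrt_nonneg _
  have h1 : traceNorm (∑ i ∈ s, Y i) = ‖(traceNorm (∑ i ∈ s, Y i) : ℂ)‖ := by
    rw [Complex.norm_real, Real.norm_of_nonneg h0]
  rw [h1, ← h]
  simp only [map_sum, sum_apply, inner_sum]
  rw [Finset.sum_comm]
  exact (norm_sum_le _ _).trans (Finset.sum_le_sum fun i _ =>
    norm_sum_inner_le_traceNorm (Y i) he _)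

theorem sum_eigenvalues_conjTranspose_mul_self (A : Matrix N N ℂ) :
    ∑ i, (Matrix.isHermitian_conjTranspose_mul_self A).eigenvalues i =
      ∑ x, ∑ y, ‖A x y‖ ^ 2 := by
  have h := (Matrix.isHermitian_conjTranspose_mul_self A).trace_eq_sum_eigenvalues
  have h2 : (Aᴴ * A).trace = ((∑ x, ∑ y, ‖A x y‖ ^ 2 : ℝ) : ℂ) := by
    rw [Finset.sum_comm]
    push_cast
    simp only [Matrix.trace, Matrix.diag, Matrix.mul_apply, Matrix.conjTranspose_apply]
    refine Finset.sum_congr rfl fun y _ => Finset.sum_congr rfl fun x _ => ?_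
    exact Complex.conj_mul' _
  rw [h2] at h
  have h3 : ((∑ x, ∑ y, ‖A x y‖ ^ 2 : ℝ) : ℂ) =
      ((∑ i, (Matrix.isHermitian_conjTranspose_mul_self A).eigenvalues i : ℝ) : ℂ) := by
    rw [h]; push_cast; rfl
  exact (Complex.ofReal_injective h3).symm

-- Cauchy–Schwarz over the nonzero singular values, whose number is the rank and whose squares sum
-- to the squared Hilbert–Schmidt norm.
open scoped ComplexOrder in
theorem traceNorm_sq_le (A : Matrix N N ℂ) :
    traceNorm A ^ 2 ≤ A.rank * ∑ x, ∑ y, ‖A x y‖ ^ 2 := by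
  classical
  set lam := (Matrix.isHermitian_conjTranspose_mul_self A).eigenvalues with hl
  have hnn : ∀ i, 0 ≤ lam i := (Matrix.posSemidef_conjTranspose_mul_self A).eigenvalues_nonneg
  have h1 : traceNorm A = ∑ i ∈ Finset.univ.filter fun i => lam i ≠ 0, √(lam i) := by
    rw [Finset.sum_filter, traceNorm]
    refine Finset.sum_congr rfl fun i _ => ?_
    split_ifs with h
    · rfl
    · change √(lam i) = 0
      rw [not_not.1 h, Real.sqrt_zero]
  have h2 : A.rank = (Finset.univ.filter fun i => lam i ≠ 0).card := by
    rw [← Matrix.rank_conjTranspose_mul_self,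
      (Matrix.isHermitian_conjTranspose_mul_self A).rank_eq_card_non_zero_eigs,
      Fintype.card_subtype]
  rw [h1, h2, ← sum_eigenvalues_conjTranspose_mul_self]
  refine sq_sum_le_card_mul_sum_sq.trans (mul_le_mul_of_nonneg_left ?_ (Nat.cast_nonneg _))
  calc ∑ i ∈ Finset.univ.filter (fun i => lam i ≠ 0), √(lam i) ^ 2
      = ∑ i ∈ Finset.univ.filter (fun i => lam i ≠ 0), lam i :=
        Finset.sum_congr rfl fun i _ => Real.sq_sqrt (hnn i)
    _ ≤ ∑ i, lam i := Finset.sum_le_sum_of_subset_of_nonneg (Finset.filter_subset _ _)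
        fun i _ _ => hnn i

theorem eq_sum_vecMulVec_singularBasis (X : Matrix N N ℂ) :
    X = ∑ i, Matrix.vecMulVec (X *ᵥ (singularBasis X i).ofLp) (star (singularBasis X i).ofLp) := by
  ext x y
  set b := singularBasis X
  have h1 := b.sum_repr' (EuclideanSpace.single y (1 : ℂ))
  have h2 := congrArg (fun z : EuclideanSpace ℂ N => (X *ᵥ z.ofLp) x) h1
  simp only [EuclideanSpace.inner_single_right, one_mul, WithLp.ofLp_sum, WithLp.ofLp_smul,
    Matrix.mulVec_sum, Matrix.mulVec_smul, Finset.sum_apply, Pi.smul_apply, smul_eq_mul] at h2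
  have h3 : (X *ᵥ (EuclideanSpace.single y (1 : ℂ)).ofLp) x = X x y := by simp
  rw [h3] at h2
  rw [← h2, Matrix.sum_apply]
  refine Finset.sum_congr rfl fun i _ => ?_
  rw [Matrix.vecMulVec_apply, mul_comm]
  rfl

end TraceNorm

/-! ### From the operator norm to the diamond norm. -/

section Diamond

variable {ι : Type*} [Fintype ι]

/-- The linear map on matrices represented by `K` on vectorized matrices. -/
def superOp (K : Matrix (ι × ι) (ι × ι) ℂ) (X : Matrix ι ι ℂ) : Matrix ι ι ℂ :=
  Matrix.of fun x y => (K *ᵥ fun p => X p.1 p.2) (x, y)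

theorem superOp_apply (K : Matrix (ι × ι) (ι × ι) ℂ) (X : Matrix ι ι ℂ) (x y : ι) :
    superOp K X x y = ∑ c, ∑ d, K (x, y) (c, d) * X c d := by
  simp only [superOp, Matrix.of_apply, Matrix.mulVec, dotProduct, Fintype.sum_prod_type]

theorem ampliate_sum (K : Matrix (ι × ι) (ι × ι) ℂ) (m : ℕ) {κ : Type*} (s : Finset κ)
    (X : κ → Matrix (ι × Fin m) (ι × Fin m) ℂ) :
    ampliate (superOp K) m (∑ i ∈ s, X i) = ∑ i ∈ s, ampliate (superOp K) m (X i) := by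
  ext x y
  simp only [ampliate, Matrix.of_apply, superOp_apply, Matrix.sum_apply, Finset.mul_sum]
  exact (Finset.sum_congr rfl fun c _ => Finset.sum_comm).trans Finset.sum_comm

theorem superOp_sub (K L : Matrix (ι × ι) (ι × ι) ℂ) (X : Matrix ι ι ℂ) :
    superOp (K - L) X = superOp K X - superOp L X := by
  ext x y
  simp [superOp, Matrix.sub_mulVec]

variable [DecidableEq ι]

theorem sum_norm_sq_superOp_le (K : Matrix (ι × ι) (ι × ι) ℂ) (X : Matrix ι ι ℂ) :
    ∑ a, ∑ b, ‖superOp K X a b‖ ^ 2 ≤ opNorm K ^ 2 * ∑ a, ∑ b, ‖X a b‖ ^ 2 := by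
  have h := (Matrix.toEuclideanCLM (𝕜 := ℂ) K).le_opNorm (WithLp.toLp 2 fun p => X p.1 p.2)
  have h2 := pow_le_pow_left₀ (norm_nonneg _) h 2
  rw [mul_pow, EuclideanSpace.norm_sq_eq, EuclideanSpace.norm_sq_eq, Fintype.sum_prod_type,
    Fintype.sum_prod_type] at h2
  exact h2

theorem sum_norm_sq_ampliate_le (K : Matrix (ι × ι) (ι × ι) ℂ) (m : ℕ)
    (X : Matrix (ι × Fin m) (ι × Fin m) ℂ) :
    ∑ x, ∑ y, ‖ampliate (superOp K) m X x y‖ ^ 2 ≤ opNorm K ^ 2 * ∑ x, ∑ y, ‖X x y‖ ^ 2 := by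
  have hre : ∀ f : ι × Fin m → ι × Fin m → ℝ, ∑ x, ∑ y, f x y =
      ∑ s, ∑ t, ∑ a, ∑ b, f (a, s) (b, t) := by
    intro f
    simp only [Fintype.sum_prod_type]
    rw [Finset.sum_comm]
    refine Finset.sum_congr rfl fun s _ => ?_
    exact (Finset.sum_congr rfl fun a _ => Finset.sum_comm).trans Finset.sum_comm
  rw [hre, hre, Finset.mul_sum]
  refine Finset.sum_le_sum fun s _ => ?_
  rw [Finset.mul_sum]
  exact Finset.sum_le_sum fun t _ =>
    sum_norm_sq_superOp_le K (Matrix.of fun a b => X (a, s) (b, t))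

/-- On a rank-one input the output factors through `ι × ι`, whatever the ancilla dimension; this
makes the diamond bound uniform in `m`. -/
theorem rank_ampliate_vecMulVec_le (K : Matrix (ι × ι) (ι × ι) ℂ) (m : ℕ)
    (u v : ι × Fin m → ℂ) :
    (ampliate (superOp K) m (Matrix.vecMulVec u v)).rank ≤ Fintype.card ι ^ 2 := by
  set A : Matrix (ι × Fin m) (ι × ι) ℂ := Matrix.of fun x p =>
    if x.1 = p.1 then u (p.2, x.2) else 0 with hA
  set B : Matrix (ι × ι) (ι × Fin m) ℂ := Matrix.of fun p y =>
    ∑ d, K (p.1, y.1) (p.2, d) * v (d, y.2) with hB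
  have h : ampliate (superOp K) m (Matrix.vecMulVec u v) = A * B := by
    ext x y
    simp only [ampliate, Matrix.of_apply, superOp_apply, Matrix.vecMulVec_apply, Matrix.mul_apply,
      hA, hB, Fintype.sum_prod_type, ite_mul, zero_mul]
    conv_rhs => rw [Finset.sum_comm]
    simp only [Finset.sum_ite_eq, Finset.mem_univ, if_true, Finset.mul_sum]
    exact Finset.sum_congr rfl fun c _ => Finset.sum_congr rfl fun d _ => by ring
  rw [h]
  refine (Matrix.rank_mul_le_left A B).trans ((Matrix.rank_le_card_width A).trans_eq ?_)
  rw [Fintype.card_prod, sq]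

theorem traceNorm_ampliate_vecMulVec_le (K : Matrix (ι × ι) (ι × ι) ℂ) (m : ℕ)
    (u v : ι × Fin m → ℂ) :
    traceNorm (ampliate (superOp K) m (Matrix.vecMulVec u v)) ≤
      Fintype.card ι * opNorm K * (‖WithLp.toLp 2 u‖ * ‖WithLp.toLp 2 v‖) := by
  have hK : 0 ≤ opNorm K := norm_nonneg _
  refine abs_le_of_sq_le_sq' ?_ (by positivity) |>.2
  refine (traceNorm_sq_le _).trans ?_
  have h1 : ((ampliate (superOp K) m (Matrix.vecMulVec u v)).rank : ℝ) ≤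
      (Fintype.card ι : ℝ) ^ 2 := by
    exact_mod_cast rank_ampliate_vecMulVec_le K m u v
  have h2 := sum_norm_sq_ampliate_le K m (Matrix.vecMulVec u v)
  have h3 : ∑ x, ∑ y, ‖Matrix.vecMulVec u v x y‖ ^ 2 =
      (‖WithLp.toLp 2 u‖ * ‖WithLp.toLp 2 v‖) ^ 2 := by
    rw [mul_pow, EuclideanSpace.norm_sq_eq, EuclideanSpace.norm_sq_eq, Finset.sum_mul_sum]
    simp only [Matrix.vecMulVec_apply, norm_mul, mul_pow]
  rw [h3] at h2
  rw [mul_pow, mul_pow, mul_assoc]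
  exact mul_le_mul h1 h2 (Finset.sum_nonneg fun x _ => Finset.sum_nonneg fun y _ => sq_nonneg _)
    (by positivity)

/-- The singular value decomposition of `X` reduces to rank-one inputs. There the square root of the
rank bound costs one factor `Fintype.card ι`, and `K` contracts the Hilbert–Schmidt norm by `opNorm
K`. -/
theorem traceNorm_ampliate_le (K : Matrix (ι × ι) (ι × ι) ℂ) (m : ℕ)
    (X : Matrix (ι × Fin m) (ι × Fin m) ℂ) :
    traceNorm (ampliate (superOp K) m X) ≤ Fintype.card ι * opNorm K * traceNorm X := by
  conv_lhs => rw [eq_sum_vecMulVec_singularBasis X, ampliate_sum]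
  refine (traceNorm_sum_le _ _).trans ?_
  rw [traceNorm_eq_sum X, Finset.mul_sum]
  refine Finset.sum_le_sum fun i _ => (traceNorm_ampliate_vecMulVec_le K m _ _).trans_eq ?_
  have h1 : ‖WithLp.toLp 2 (star (singularBasis X i).ofLp)‖ = 1 := by
    rw [← (singularBasis X).orthonormal.1 i, EuclideanSpace.norm_eq, EuclideanSpace.norm_eq]
    simp
  rw [h1, mul_one]
  rfl

theorem diamondNorm_superOp_le (K : Matrix (ι × ι) (ι × ι) ℂ) :
    diamondNorm (superOp K) ≤ ENNReal.ofReal (Fintype.card ι * opNorm K) := by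
  have hK : 0 ≤ opNorm K := norm_nonneg _
  refine iSup_le fun m => iSup_le fun X => iSup_le fun hX => ENNReal.ofReal_le_ofReal ?_
  exact (traceNorm_ampliate_le K m X).trans (mul_le_of_le_one_right (by positivity) hX)

theorem momentChannel_eq_superOp {D : Type*} [Fintype D] [DecidableEq D] (k : ℕ)
    (ν : Measure (Matrix.unitaryGroup D ℂ)) [IsFiniteMeasure ν]
    (X : Matrix (Fin k → D) (Fin k → D) ℂ) :
    momentChannel k ν X = superOp (momentOperator k ν) X := by
  ext x y
  simp only [momentChannel, Matrix.of_apply, superOp_apply, momentOperator]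
  have h : ∀ U : Matrix.unitaryGroup D ℂ, (tensorPow k U.1 * X * tensorPow k U.1ᴴ) x y =
      ∑ c, ∑ d, tensorPowConj k U.1 (x, y) (c, d) * X c d := by
    intro U
    simp only [Matrix.mul_apply, Finset.sum_mul]
    rw [Finset.sum_comm]
    refine Finset.sum_congr rfl fun c _ => Finset.sum_congr rfl fun d _ => ?_
    simp only [tensorPowConj, tensorPow, Matrix.kronecker, Matrix.kroneckerMap_apply,
      Matrix.of_apply, Matrix.map_apply, Matrix.conjTranspose_apply]
    ring
  simp only [h]
  have hint : ∀ c d, Integrable (fun U : Matrix.unitaryGroup D ℂ =>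
      tensorPowConj k U.1 (x, y) (c, d) * X c d) ν := fun c d =>
    (integrable_tensorPowConj k ν _ _).mul_const _
  rw [integral_finsetSum]
  · refine Finset.sum_congr rfl fun c _ => ?_
    rw [integral_finsetSum _ fun d _ => hint c d]
    exact Finset.sum_congr rfl fun d _ => integral_mul_const _ _
  · exact fun c _ => integrable_finsetSum _ fun d _ => hint c d

theorem isDiamondApproxDesign_of_opNorm {q n k : ℕ} (hq : 0 < q) {ε : ℝ}
    (ν : Measure (Matrix.unitaryGroup (Config q n) ℂ)) [IsFiniteMeasure ν]
    (h : opNorm (momentOperator k ν - momentOperator k (haar (Config q n))) ≤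
      ε / (q : ℝ) ^ (2 * n * k)) : IsDiamondApproxDesign k ε ν := by
  have hq' : (0 : ℝ) < q := by exact_mod_cast hq
  have hΦ : (fun X => momentChannel k ν X - momentChannel k (haar (Config q n)) X) =
      superOp (momentOperator k ν - momentOperator k (haar (Config q n))) := by
    funext X
    rw [superOp_sub, momentChannel_eq_superOp, momentChannel_eq_superOp]
  rw [IsDiamondApproxDesign, hΦ]
  refine (diamondNorm_superOp_le _).trans (ENNReal.ofReal_le_ofReal ?_)
  have hcard : (Fintype.card (Fin k → Config q n) : ℝ) = (q : ℝ) ^ (n * k) := by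
    simp only [Fintype.card_fun, Fintype.card_fin]
    push_cast
    rw [← pow_mul]
  rw [hcard]
  calc (q : ℝ) ^ (n * k) * opNorm _ ≤ (q : ℝ) ^ (n * k) * (ε / (q : ℝ) ^ (2 * n * k)) := by gcongr
    _ = ε / (q : ℝ) ^ (n * k) := by
      rw [show 2 * n * k = n * k + n * k by ring, pow_add]
      field_simp

end Diamond

/-! ### Asymptotics of the gap and circuit sizes. -/

section Designs

variable {q n : ℕ}

/-- The extreme case is q = 2, where 2q/(q²+1) = 4/5. -/
theorem rate_const_inv_le (hq : 2 ≤ q) : (1 - 2 * (q : ℝ) / ((q : ℝ) ^ 2 + 1))⁻¹ ≤ 5 := by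
  have hq' : (2 : ℝ) ≤ q := by exact_mod_cast hq
  refine inv_le_of_inv_le₀ (by norm_num) ?_
  rw [le_sub_comm, div_le_iff₀ (by positivity)]
  nlinarith

theorem isTheta_completeGraphGap (hq : 2 ≤ q) :
    (fun n : ℕ => completeGraphGap q n 2) =Θ[Filter.atTop] (fun n : ℕ => (n : ℝ)) := by
  have hc := rate_const_pos hq
  have hc1 := rate_const_le_one q
  set c : ℝ := 1 - 2 * (q : ℝ) / ((q : ℝ) ^ 2 + 1) with hcdef
  have hbounds : ∀ n : ℕ, 2 ≤ n →
      c / 2 * n ≤ completeGraphGap q n 2 ∧ completeGraphGap q n 2 ≤ n := by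
    intro n hn
    obtain ⟨h1, h2⟩ := completeGraphGap_bounds hq hn
    have hn' : (2 : ℝ) ≤ n := by exact_mod_cast hn
    rw [gapBound, ← hcdef] at h1
    -- 1 + c(n - 2) ≥ cn/2 holds for n ≥ 2 because c ≤ 1.
    exact ⟨by nlinarith, by linarith⟩
  constructor
  · refine Asymptotics.IsBigO.of_bound 1 ?_
    filter_upwards [Filter.eventually_ge_atTop 2] with n hn
    obtain ⟨h1, h2⟩ := hbounds n hn
    have h0 : 0 ≤ c / 2 * (n : ℝ) := by positivity
    rw [Real.norm_of_nonneg (h0.trans h1), Real.norm_of_nonneg (Nat.cast_nonneg n), one_mul]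
    exact h2
  · refine Asymptotics.IsBigO.of_bound (c / 2)⁻¹ ?_
    filter_upwards [Filter.eventually_ge_atTop 2] with n hn
    obtain ⟨h1, -⟩ := hbounds n hn
    have h0 : 0 ≤ c / 2 * (n : ℝ) := by positivity
    rw [Real.norm_of_nonneg (h0.trans h1), Real.norm_of_nonneg (Nat.cast_nonneg n),
      le_inv_mul_iff₀ (by positivity)]
    exact h1

theorem isApproxDesign_circuitMeasure (hq : 2 ≤ q) (hn : 2 ≤ n) {ε : ℝ} (hε : 0 < ε) {t : ℕ}
    (ht : (n : ℝ) / 2 * (1 - 2 * (q : ℝ) / ((q : ℝ) ^ 2 + 1))⁻¹ *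
      (4 * (n : ℝ) * Real.log q + Real.log (1 / ε)) ≤ (t : ℝ)) :
    IsDiamondApproxDesign 2 ε (circuitMeasure q (⊤ : SimpleGraph (Fin n)) t) ∧
      IsOperatorApproxDesign 2 ε (circuitMeasure q (⊤ : SimpleGraph (Fin n)) t) := by
  have := nonempty_edge_top hn
  have : IsProbabilityMeasure (circuitMeasure q (⊤ : SimpleGraph (Fin n)) t) :=
    isProbabilityMeasure_circuitMeasure ..
  have h : IsOperatorApproxDesign 2 ε (circuitMeasure q (⊤ : SimpleGraph (Fin n)) t) := by
    rw [IsOperatorApproxDesign, show 2 * n * 2 = 4 * n by ring]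
    exact (opNorm_circuit_le hq hn t).trans (stepRate_pow_le hq hn hε ht)
  exact ⟨isDiamondApproxDesign_of_opNorm (by omega) _ h, h⟩

/-- The absolute constant is 10 = 5 · 4 / 2; ε ≤ 1 makes log(1/ε) nonnegative, so the 4 may be taken
out of the bracket. -/
theorem circuit_size_le (hq : 2 ≤ q) {ε : ℝ} (hε : 0 < ε) (hε1 : ε ≤ 1) :
    (n : ℝ) / 2 * (1 - 2 * (q : ℝ) / ((q : ℝ) ^ 2 + 1))⁻¹ *
      (4 * (n : ℝ) * Real.log q + Real.log (1 / ε)) ≤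
    10 * (n : ℝ) * ((n : ℝ) * Real.log q + Real.log (1 / ε)) := by
  have hlq : 0 ≤ Real.log q := Real.log_natCast_nonneg q
  have hle : 0 ≤ Real.log (1 / ε) := Real.log_nonneg ((one_le_div hε).2 hε1)
  calc _ ≤ (n : ℝ) / 2 * 5 * (4 * ((n : ℝ) * Real.log q + Real.log (1 / ε))) := by
        gcongr
        · exact rate_const_inv_le hq
        · linarith
    _ = _ := by ring

end Designs

end RQC

end

theorem mainTheorem6 :
    (∀ q : ℕ, 2 ≤ q →
      (fun n : ℕ => RQC.completeGraphGap q n 2) =Θ[Filter.atTop] (fun n : ℕ => (n : ℝ))) ∧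
    (∀ q n : ℕ, 2 ≤ q → 2 ≤ n →
      ((n : ℝ) - 2) * (1 - 2 * (q : ℝ) / ((q : ℝ) ^ 2 + 1)) ≤ RQC.completeGraphGap q n 2 ∧
      RQC.completeGraphGap q n 2 ≤ (n : ℝ) - 1) ∧
    (∀ q n : ℕ, 2 ≤ q → 2 ≤ n → ∀ ε : ℝ, 0 < ε → ∀ t : ℕ,
      (n : ℝ) / 2 * (1 - 2 * (q : ℝ) / ((q : ℝ) ^ 2 + 1))⁻¹ *
          (4 * (n : ℝ) * Real.log q + Real.log (1 / ε)) ≤ (t : ℝ) →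
        RQC.IsDiamondApproxDesign 2 ε
            (RQC.circuitMeasure q (⊤ : SimpleGraph (Fin n)) t) ∧
          RQC.IsOperatorApproxDesign 2 ε
            (RQC.circuitMeasure q (⊤ : SimpleGraph (Fin n)) t)) ∧
    (∃ C : ℝ, 0 < C ∧ ∀ q n : ℕ, 2 ≤ q → 2 ≤ n → ∀ ε : ℝ, 0 < ε → ε ≤ 1 → ∀ t : ℕ,
      C * (n : ℝ) * ((n : ℝ) * Real.log q + Real.log (1 / ε)) ≤ (t : ℝ) →
        RQC.IsDiamondApproxDesign 2 ε
            (RQC.circuitMeasure q (⊤ : SimpleGraph (Fin n)) t) ∧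
          RQC.IsOperatorApproxDesign 2 ε
            (RQC.circuitMeasure q (⊤ : SimpleGraph (Fin n)) t)) := by
  refine ⟨fun q hq => RQC.isTheta_completeGraphGap hq, fun q n hq hn => ?_,
    fun q n hq hn ε hε t ht => RQC.isApproxDesign_circuitMeasure hq hn hε ht,
    10, by norm_num, fun q n hq hn ε hε hε1 t ht =>
      RQC.isApproxDesign_circuitMeasure hq hn hε ((RQC.circuit_size_le hq hε hε1).trans ht)⟩
  obtain ⟨h1, h2⟩ := RQC.completeGraphGap_bounds hq hn
  refine ⟨le_trans ?_ h1, h2⟩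
  rw [RQC.gapBound, mul_comm]
  linarith
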